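/- **Theorem (Constant propagation).** Fix an implementation environment for C (a totally ordered set $K$ of integer ranks; the number of bits per byte, at least $8$; sizes and endianness permutations of integers, with two's complement representation; and sizes, alignments and field layouts of types subject to the usual compatibility laws), and a well-formed type environment $\Gamma$, that is, finite maps assigning field types to struct/union tags and signatures to function names, built up declaration by declaration. Work in the following memory model. *Memory.* An object is a tree following its C type. The leaves at base types are sequences of bits, and padding is stored explicitly. A union node either records its current variant, the tree of that variant and padding, or has an unspecified variant and is a plain bit sequence. A bit is indeterminate, concrete ($0$/$1$), or the $i$-th fragment of a (frozen) pointer, and carries a permission: a lockable pair (count, fraction) of rationals for non-const objects, or a fraction for const objects. A memory $m$ is a finite map from object identifiers to trees (with a malloc flag) or to types of deallocated objects. It is *valid* with respect to $\Gamma$ and a memory typing environment $\Delta$ (a finite map from object identifiers to a type and a deallocation flag) if each deallocated object has a valid type, the one assigned to it by $\Delta$, and is marked deallocated in $\Delta$, and if each live object is marked alive in $\Delta$, is a well-typed tree of the type assigned by $\Delta$, and does not consist only of indeterminate bits with empty permission. *Addresses.* An address consists of an object identifier, a path into the object to a subobject of some type $\sigma$ (where each union step is annotated as frozen, forbidding type-punning,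 or unfrozen), a byte offset, and the type to which it is cast; that type is $\sigma$, `unsigned char`, or the anonymous `void*` target. If it differs from $\sigma$, then $a$ is a byte address and refers to a single byte of the subobject. *Operations.* Looking up $a$ in $m$ is partial. It yields the value represented by the tree at $a$ (for a byte address: by the byte at $a$), provided that $a$ is not an end-of-array address, that type-punning happens only at unfrozen union steps (to a different variant than the current one) and reinterprets only unshared bits, and that all the bits looked up are readable. $a$ is *writable* in $m$ if there is a tree at $a$ in this sense all of whose bits have writable permission. Storing $v$ at $a$, written $m\langle a := v\rangle$, replaces the tree (or byte) at $a$ by the representation of $v$ with the old permissions, freezes the pointers in $v$, keeps padding indeterminate, and sets the variants of the unions on the path to those selected by $a$. *Statement.* Let $\tau$ be a type, $m$ a memory, $a$ an address and $v$ a value such that $m$ is valid with respect to $\Gamma$ and $\Delta$; $a$ is well-typed with type $\tau$ with respect to $\Gamma,\Delta$; $v$ is well-typed with type $\tau$ with respect to $\Gamma,\Delta$; and $a$ is writable in $m$. Then there is a value $v'$ such that looking up $a$ in $m\langle a := v\rangle$ yields $v'$, and $v'$ refines to $v$ at type $\tau$ with respect to $\Gamma$ and $\Delta$ (for source and target) under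 the identity renaming of objects. Here "$v'$ refines to $v$" means that $v$ is obtained from $v'$, along the structure of values, by replacing indeterminate base values by arbitrary well-typed ones, frozen union annotations in pointers by unfrozen ones, pointers to deallocated objects (and, in byte values, indeterminate bits and fragments of such pointers) by arbitrary well-typed values (bits), and unions of a specified variant by unions of an unspecified variant whose corresponding component is refined. No restriction is made on whether $a$ is a byte address or not. -/

import Mathlib

/-! A memory model for C: types, implementation environments, permissions, addresses and pointers,
bits, memory trees, abstract values, memory operations, and refinements. -/

namespace CH2O

universe u v

/-! ### Integer types and integer coding -/

inductive Signedness where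
  | signed
  | unsigned

structure IntType (K : Type u) where
  sign : Signedness
  rank : K

/-- An integer coding environment whose totally ordered set of ranks is `K`. -/
structure IntEnv (K : Type u) [LinearOrder K] where
  charRank : K
  shortRank : K
  intRank : K
  longRank : K
  longlongRank : K
  sizeRank : K
  char_lt_short : charRank < shortRank
  short_lt_int : shortRank < intRank
  int_lt_long : intRank < longRank
  long_lt_longlong : longRank < longlongRank
  charBits : ℕ
  charBits_ge : 8 ≤ charBits
  charSignedness : Signedness
  rankSize : K → ℕ
  rankSize_pos : ∀ k, 0 < rankSize k
  rankSize_mono : Monotone rankSize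
  rankSize_char : rankSize charRank = 1
  endianize : K → List Bool → List Bool
  deendianize : K → List Bool → List Bool
  deendianize_endianize : ∀ k l, deendianize k (endianize k l) = l
  endianize_deendianize : ∀ k l, endianize k (deendianize k l) = l
  endianize_perm : ∀ k l, (endianize k l).Perm l

/-- `x` is in the range of the integer type. -/
def IntTyped {K : Type u} [LinearOrder K] (E : IntEnv K) (x : ℤ) : IntType K → Prop
  | ⟨.signed, k⟩ =>
      -2 ^ (E.charBits * E.rankSize k - 1) ≤ x ∧ x < 2 ^ (E.charBits * E.rankSize k - 1)
  | ⟨.unsigned, k⟩ => 0 ≤ x ∧ x < 2 ^ (E.charBits * E.rankSize k)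

/-- The natural number with the given little endian binary expansion. -/
def natOfBits : List Bool → ℕ
  | [] => 0
  | b :: l => b.toNat + 2 * natOfBits l

/-- Encode an integer; `Int.testBit` reads off two's complement bits. -/
def intToBits {K : Type u} [LinearOrder K] (E : IntEnv K) (τi : IntType K) (x : ℤ) : List Bool :=
  E.endianize τi.rank ((List.range (E.charBits * E.rankSize τi.rank)).map fun i => x.testBit i)

/-- Decode an integer (two's complement in the signed case). -/
def intOfBits {K : Type u} [LinearOrder K] (E : IntEnv K) (τi : IntType K) (l : List Bool) : ℤ :=
  let β := E.deendianize τi.rank l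
  match τi.sign with
  | .unsigned => natOfBits β
  | .signed => if β.getLastD false then natOfBits β - 2 ^ β.length else natOfBits β

/-! ### Types and type environments -/

mutual
/-- Full types. -/
inductive CType (K : Type u) : Type u where
  | base : BaseType K → CType K
  | array : CType K → ℕ → CType K
  | struct : String → CType K
  | union : String → CType K
/-- Points-to types. -/
inductive PtrType (K : Type u) : Type u where
  | type : CType K → PtrType K
  | any : PtrType K
  | func : List (CType K) → CType K → PtrType K
/-- Base types. -/
inductive BaseType (K : Type u) : Type u where
  | int : IntType K → BaseType K
  | ptr : PtrType K → BaseType K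
  | void : BaseType K
end

/-- Type environments: finite maps that assign fields to struct and union tags, and argument
and return types to function names. -/
structure Env (K : Type u) where
  compounds : Finmap (fun _ : String => List (CType K))
  funs : Finmap (fun _ : String => List (CType K) × CType K)

namespace Env

variable {K : Type u}

/-- The fields of the struct or union with tag `t`. -/
def fields (Γ : Env K) (t : String) : Option (List (CType K)) := Γ.compounds.lookup t

/-- The type of the `i`th field of the struct or union with tag `t`. -/
def field (Γ : Env K) (t : String) (i : ℕ) : Option (CType K) := (Γ.fields t).bind fun τs => τs[i]?

/-- Inclusion of environments. -/
def Sub (Γ₁ Γ₂ : Env K) : Prop :=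
  (∀ t τs, Γ₁.compounds.lookup t = some τs → Γ₂.compounds.lookup t = some τs) ∧
  (∀ f σ, Γ₁.funs.lookup f = some σ → Γ₂.funs.lookup f = some σ)

end Env

mutual
/-- Valid points-to types (incomplete structs and unions are allowed). -/
inductive PtrTypeValid {K : Type u} (Γ : Env K) : PtrType K → Prop where
  | any : PtrTypeValid Γ .any
  | func (τs : List (CType K)) (τ : CType K) :
      (∀ σ ∈ τs, PtrTypeValid Γ (.type σ)) → PtrTypeValid Γ (.type τ) →
      PtrTypeValid Γ (.func τs τ)
  | base (τb : BaseType K) : BaseTypeValid Γ τb → PtrTypeValid Γ (.type (.base τb))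
  | array (τ : CType K) (n : ℕ) :
      TypeValid Γ τ → n ≠ 0 → PtrTypeValid Γ (.type (.array τ n))
  | struct (t : String) : PtrTypeValid Γ (.type (.struct t))
  | union (t : String) : PtrTypeValid Γ (.type (.union t))
/-- Valid base types. -/
inductive BaseTypeValid {K : Type u} (Γ : Env K) : BaseType K → Prop where
  | int (τi : IntType K) : BaseTypeValid Γ (.int τi)
  | ptr (τp : PtrType K) : PtrTypeValid Γ τp → BaseTypeValid Γ (.ptr τp)
  | void : BaseTypeValid Γ .void
/-- Valid full types. -/
inductive TypeValid {K : Type u} (Γ : Env K) : CType K → Prop where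
  | base (τb : BaseType K) : BaseTypeValid Γ τb → TypeValid Γ (.base τb)
  | array (τ : CType K) (n : ℕ) : TypeValid Γ τ → n ≠ 0 → TypeValid Γ (.array τ n)
  | struct (t : String) : t ∈ Γ.compounds → TypeValid Γ (.struct t)
  | union (t : String) : t ∈ Γ.compounds → TypeValid Γ (.union t)
end

/-- Well-formed type environments. -/
inductive EnvValid {K : Type u} : Env K → Prop where
  | empty : EnvValid ⟨∅, ∅⟩
  | compound (Γ : Env K) (t : String) (τs : List (CType K)) :
      EnvValid Γ → (∀ τ ∈ τs, TypeValid Γ τ) → τs ≠ [] → t ∉ Γ.compounds →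
      EnvValid ⟨Γ.compounds.insert t τs, Γ.funs⟩
  | func (Γ : Env K) (f : String) (τs : List (CType K)) (τ : CType K) :
      EnvValid Γ → (∀ σ ∈ τs, PtrTypeValid Γ (.type σ)) → PtrTypeValid Γ (.type τ) →
      f ∉ Γ.funs → EnvValid ⟨Γ.compounds, Γ.funs.insert f (τs, τ)⟩

/-! ### Recursion over types

In a well-formed environment the fields of a struct or union only mention tags that were declared
earlier, so the number of declared tags bounds the nesting depth of tags in a valid type.
The bound `d` below is that depth; `typeRec_struct` and `typeRec_union` are the intended recursion
equations, in which no bound occurs. -/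

section TypeRec

variable {K : Type u} {α : Type v}

/-- Recursion over types through the fields of structs and unions, up to nesting depth `d`. -/
def typeRecAux (Γ : Env K) (base : BaseType K → α) (array : CType K → ℕ → α → α)
    (struct union : String → List (CType K × α) → α) (d : ℕ) : CType K → α
  | .base τb => base τb
  | .array τ n => array τ n (typeRecAux Γ base array struct union d τ)
  | .struct t =>
      match d with
      | 0 => struct t []
      | d + 1 => struct t (((Γ.fields t).getD []).map fun τ =>
          (τ, typeRecAux Γ base array struct union d τ))
  | .union t =>
      match d with
      | 0 => union t []
      | d + 1 => union t (((Γ.fields t).getD []).map fun τ =>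
          (τ, typeRecAux Γ base array struct union d τ))
termination_by τ => (d, τ)

/-- Recursion over types through the fields of structs and unions. -/
def typeRec (Γ : Env K) (base : BaseType K → α) (array : CType K → ℕ → α → α)
    (struct union : String → List (CType K × α) → α) : CType K → α :=
  typeRecAux Γ base array struct union Γ.compounds.keys.card

variable (base : BaseType K → α) (array : CType K → ℕ → α → α)
  (struct union : String → List (CType K × α) → α)

theorem typeRecAux_congr_of_fields (Γ Γ' : Env K) (N : ℕ)
    (hsub : ∀ t τs, Γ.fields t = some τs → Γ'.fields t = some τs)
    (h : ∀ t τs, Γ.fields t = some τs → 1 ≤ N ∧ ∀ τ ∈ τs, ∀ n m, N ≤ n + 1 → N ≤ m + 1 →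
      typeRecAux Γ' base array struct union n τ = typeRecAux Γ' base array struct union m τ)
    (n m : ℕ) (hn : N ≤ n) (hm : N ≤ m) : ∀ τ : CType K, TypeValid Γ τ →
      typeRecAux Γ' base array struct union n τ = typeRecAux Γ' base array struct union m τ
  | .base τb, _ => by simp only [typeRecAux]
  | .array τ k, hτ => by
      cases hτ with
      | array _ _ hτ _ =>
        simp only [typeRecAux]
        rw [typeRecAux_congr_of_fields Γ Γ' N hsub h n m hn hm τ hτ]
  | .struct t, hτ => by
      cases hτ with
      | struct _ ht =>
        obtain ⟨τs, hτs⟩ := Finmap.mem_iff.1 ht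
        obtain ⟨h1, h2⟩ := h t τs hτs
        obtain ⟨n, rfl⟩ : ∃ k, n = k + 1 := ⟨n - 1, by omega⟩
        obtain ⟨m, rfl⟩ : ∃ k, m = k + 1 := ⟨m - 1, by omega⟩
        simp only [typeRecAux, hsub t τs hτs, Option.getD_some]
        exact congrArg _ (List.map_congr_left fun τ hτ => by rw [h2 τ hτ n m hn hm])
  | .union t, hτ => by
      cases hτ with
      | union _ ht =>
        obtain ⟨τs, hτs⟩ := Finmap.mem_iff.1 ht
        obtain ⟨h1, h2⟩ := h t τs hτs
        obtain ⟨n, rfl⟩ : ∃ k, n = k + 1 := ⟨n - 1, by omega⟩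
        obtain ⟨m, rfl⟩ : ∃ k, m = k + 1 := ⟨m - 1, by omega⟩
        simp only [typeRecAux, hsub t τs hτs, Option.getD_some]
        exact congrArg _ (List.map_congr_left fun τ hτ => by rw [h2 τ hτ n m hn hm])

theorem typeRecAux_congr_fields {Γ : Env K} (hΓ : EnvValid Γ) (Γ' : Env K)
    (hsub : ∀ t τs, Γ.fields t = some τs → Γ'.fields t = some τs) (t : String)
    (τs : List (CType K)) (ht : Γ.fields t = some τs) :
    1 ≤ Γ.compounds.keys.card ∧ ∀ τ ∈ τs, ∀ n m, Γ.compounds.keys.card ≤ n + 1 →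
      Γ.compounds.keys.card ≤ m + 1 →
      typeRecAux Γ' base array struct union n τ = typeRecAux Γ' base array struct union m τ := by
  induction hΓ generalizing t τs with
  | empty => simp [Env.fields] at ht
  | compound Γ t₀ τs₀ hΓ hτs _ ht₀ ih =>
    have hold : ∀ t τs, Γ.fields t = some τs →
        (⟨Γ.compounds.insert t₀ τs₀, Γ.funs⟩ : Env K).fields t = some τs := by
      intro t τs h
      have hne : t ≠ t₀ := by
        rintro rfl
        exact ht₀ (Finmap.mem_of_lookup_eq_some h)
      simpa [Env.fields, Finmap.lookup_insert_of_ne _ hne] using h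
    have hsub' := fun t τs h => hsub t τs (hold t τs h)
    have hcard : (Γ.compounds.insert t₀ τs₀).keys.card = Γ.compounds.keys.card + 1 := by
      have : (Γ.compounds.insert t₀ τs₀).keys = insert t₀ Γ.compounds.keys := by
        ext x
        simp [Finmap.mem_keys, Finmap.mem_insert]
      rw [this, Finset.card_insert_of_notMem (by simpa [Finmap.mem_keys] using ht₀)]
    simp only [hcard]
    refine ⟨by omega, fun τ hτ n m hn hm => ?_⟩
    by_cases hne : t = t₀
    · subst hne
      obtain rfl : τs₀ = τs := by simpa [Env.fields] using ht
      exact typeRecAux_congr_of_fields base array struct union Γ Γ' _ hsub' (ih hsub') n m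
        (by omega) (by omega) τ (hτs τ hτ)
    · have ht' : Γ.fields t = some τs := by
        simpa [Env.fields, Finmap.lookup_insert_of_ne _ hne] using ht
      exact (ih hsub' t τs ht').2 τ hτ n m (by omega) (by omega)
  | func Γ f τs₀ τ₀ hΓ _ _ _ ih => exact ih hsub t τs ht

theorem typeRec_array (Γ : Env K) (τ : CType K) (n : ℕ) :
    typeRec Γ base array struct union (.array τ n) =
      array τ n (typeRec Γ base array struct union τ) := by
  simp only [typeRec, typeRecAux]

theorem typeRec_struct {Γ : Env K} (hΓ : EnvValid Γ) (t : String) (τs : List (CType K))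
    (ht : Γ.fields t = some τs) :
    typeRec Γ base array struct union (.struct t) =
      struct t (τs.map fun τ => (τ, typeRec Γ base array struct union τ)) := by
  obtain ⟨h1, h2⟩ := typeRecAux_congr_fields base array struct union hΓ Γ (fun _ _ h => h) t τs ht
  obtain ⟨n, hn⟩ : ∃ k, Γ.compounds.keys.card = k + 1 := ⟨_, (Nat.sub_add_cancel h1).symm⟩
  simp only [typeRec, hn, typeRecAux, ht, Option.getD_some]
  exact congrArg _ (List.map_congr_left fun τ hτ => by rw [h2 τ hτ n (n + 1) (by omega) (by omega)])

theorem typeRec_union {Γ : Env K} (hΓ : EnvValid Γ) (t : String) (τs : List (CType K))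
    (ht : Γ.fields t = some τs) :
    typeRec Γ base array struct union (.union t) =
      union t (τs.map fun τ => (τ, typeRec Γ base array struct union τ)) := by
  obtain ⟨h1, h2⟩ := typeRecAux_congr_fields base array struct union hΓ Γ (fun _ _ h => h) t τs ht
  obtain ⟨n, hn⟩ : ∃ k, Γ.compounds.keys.card = k + 1 := ⟨_, (Nat.sub_add_cancel h1).symm⟩
  simp only [typeRec, hn, typeRecAux, ht, Option.getD_some]
  exact congrArg _ (List.map_congr_left fun τ hτ => by rw [h2 τ hτ n (n + 1) (by omega) (by omega)])

end TypeRec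

/-! ### Implementation environments -/

/-- An implementation environment: sizes, alignments and layout of types. -/
structure ImplEnv (K : Type u) [LinearOrder K] extends IntEnv K where
  sizeOf : Env K → CType K → ℕ
  alignOf : Env K → CType K → ℕ
  fieldSizes : Env K → List (CType K) → List ℕ
  sizeOf_int : ∀ Γ τi, sizeOf Γ (.base (.int τi)) = rankSize τi.rank
  sizeOf_ptr_ne : ∀ Γ τp, sizeOf Γ (.base (.ptr τp)) ≠ 0
  sizeOf_void_ne : ∀ Γ, sizeOf Γ (.base .void) ≠ 0
  sizeOf_array : ∀ Γ τ n, sizeOf Γ (.array τ n) = n * sizeOf Γ τ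
  sizeOf_struct : ∀ Γ t τs, EnvValid Γ → Γ.fields t = some τs →
    sizeOf Γ (.struct t) = (fieldSizes Γ τs).sum
  sizeOf_fields : ∀ Γ τs, EnvValid Γ →
    List.Forall₂ (fun τ z => sizeOf Γ τ ≤ z) τs (fieldSizes Γ τs)
  sizeOf_union : ∀ Γ t τs, EnvValid Γ → Γ.fields t = some τs →
    ∀ τ ∈ τs, sizeOf Γ τ ≤ sizeOf Γ (.union t)
  alignOf_array : ∀ Γ τ n, alignOf Γ τ ∣ alignOf Γ (.array τ n)
  alignOf_struct : ∀ Γ t τs, EnvValid Γ → Γ.fields t = some τs →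
    ∀ τ ∈ τs, alignOf Γ τ ∣ alignOf Γ (.struct t)
  alignOf_union : ∀ Γ t τs, EnvValid Γ → Γ.fields t = some τs →
    ∀ τ ∈ τs, alignOf Γ τ ∣ alignOf Γ (.union t)
  alignOf_dvd_sizeOf : ∀ Γ τ, EnvValid Γ → TypeValid Γ τ → alignOf Γ τ ∣ sizeOf Γ τ
  alignOf_dvd_offset : ∀ Γ τs, EnvValid Γ → (∀ τ ∈ τs, TypeValid Γ τ) →
    ∀ i τ, τs[i]? = some τ → alignOf Γ τ ∣ ((fieldSizes Γ τs).take i).sum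
  sizeOf_weaken : ∀ Γ₁ Γ₂ τ, EnvValid Γ₁ → EnvValid Γ₂ → TypeValid Γ₁ τ → Γ₁.Sub Γ₂ →
    sizeOf Γ₁ τ = sizeOf Γ₂ τ
  alignOf_weaken : ∀ Γ₁ Γ₂ τ, EnvValid Γ₁ → EnvValid Γ₂ → TypeValid Γ₁ τ → Γ₁.Sub Γ₂ →
    alignOf Γ₁ τ = alignOf Γ₂ τ
  fieldSizes_weaken : ∀ Γ₁ Γ₂ τs, EnvValid Γ₁ → EnvValid Γ₂ → (∀ τ ∈ τs, TypeValid Γ₁ τ) →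
    Γ₁.Sub Γ₂ → fieldSizes Γ₁ τs = fieldSizes Γ₂ τs

section Layout

variable {K : Type u} [LinearOrder K] (E : ImplEnv K) (Γ : Env K)

def bitSize (τ : CType K) : ℕ := E.sizeOf Γ τ * E.charBits

def fieldBitSizes (τs : List (CType K)) : List ℕ := (E.fieldSizes Γ τs).map (· * E.charBits)

/-- The integer type `unsigned char`. -/
def ucharInt : IntType K := ⟨.unsigned, E.charRank⟩

/-- The full type `unsigned char`. -/
def uchar : CType K := .base (.int (ucharInt E))

/-- The unit of pointer arithmetic for a points-to type. -/
def ptrSize : PtrType K → ℕ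
  | .type τ => E.sizeOf Γ τ
  | _ => 1

end Layout

/-! ### Permissions -/

/-- Permissions: lockable counting fractional permissions (for objects that are not const
qualified) or fractional permissions (for const qualified objects). -/
inductive Perm where
  | unlocked (count frac : ℚ)
  | locked (count frac : ℚ)
  | const (frac : ℚ)

namespace Perm

/-- The empty permission. -/
def empty : Perm := unlocked 0 0

def Valid : Perm → Prop
  | unlocked x y => 0 ≤ y ∧ y ≤ 1 ∧ (y = 0 → x ≤ 0) ∧ (y = 1 → 0 ≤ x)
  | locked x y => y = 1 ∧ 0 ≤ x
  | const y => 0 < y ∧ y ≤ 1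

def Unmapped : Perm → Prop
  | unlocked x y => y = 0 ∧ x ≤ 0
  | locked _ _ => False
  | const _ => False

def Unshared : Perm → Prop
  | unlocked x y => y = 1 ∧ 0 ≤ x
  | locked x y => y = 1 ∧ 0 ≤ x
  | const y => y = 1

end Perm

inductive PermKind where
  | existing
  | locked
  | readable
  | writable

/-- The order on optional permission kinds (`none` is the kind of permissions that allow no
operation). -/
inductive KindLE : Option PermKind → Option PermKind → Prop where
  | refl (k : Option PermKind) : KindLE k k
  | none (k : Option PermKind) : KindLE none k
  | existing_locked : KindLE (some .existing) (some .locked)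
  | existing_readable : KindLE (some .existing) (some .readable)
  | existing_writable : KindLE (some .existing) (some .writable)
  | locked_writable : KindLE (some .locked) (some .writable)
  | readable_writable : KindLE (some .readable) (some .writable)

/-- The kind of a permission. -/
def Perm.kind : Perm → Option PermKind
  | .unlocked x y =>
      if y = 0 then (if x = 0 then none else some .existing)
      else if y = 1 then some .writable else some .readable
  | .locked _ _ => some .locked
  | .const y => if y = 0 then none else some .readable

/-! ### References, addresses and pointers -/

/-- Object identifiers. -/
abbrev Index := ℕ

/-- Whether type-punning through a union reference is allowed (`unfrozen`) or not (`frozen`). -/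
inductive Punning where
  | frozen
  | unfrozen

/-- Reference segments. -/
inductive RefSeg (K : Type u) where
  | array : ℕ → CType K → ℕ → RefSeg K
  | struct : ℕ → String → RefSeg K
  | union : ℕ → String → Punning → RefSeg K

/-- References: paths, listed from the top of an object downwards. -/
abbrev Ref (K : Type u) := List (RefSeg K)

/-- The address of byte offset `off` in the subobject of type `subType` at reference `ref` of the
object `idx` of type `objType`, cast to `ptrType`. -/
structure Addr (K : Type u) where
  idx : Index
  objType : CType K
  ref : Ref K
  off : ℕ
  subType : CType K
  ptrType : PtrType K

inductive Ptr (K : Type u) where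
  | null : PtrType K → Ptr K
  | addr : Addr K → Ptr K
  | func : String → List (CType K) → CType K → Ptr K

section Refs

variable {K : Type u}

def RefSeg.freeze : RefSeg K → RefSeg K
  | .array i τ n => .array i τ n
  | .struct i t => .struct i t
  | .union i t _ => .union i t .frozen

def Ref.freeze (r : Ref K) : Ref K := r.map RefSeg.freeze

def Addr.freeze (a : Addr K) : Addr K := { a with ref := Ref.freeze a.ref }

def Ptr.freeze : Ptr K → Ptr K
  | .null τp => .null τp
  | .addr a => .addr a.freeze
  | .func f τs τ => .func f τs τ

/-- `p` is frozen. -/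
def Ptr.Frozen (p : Ptr K) : Prop := p.freeze = p

def Ptr.typeOf : Ptr K → PtrType K
  | .null τp => τp
  | .addr a => a.ptrType
  | .func _ τs τ => .func τs τ

/-- A reference segment selects a direct subobject type. -/
inductive RefSegTyped (Γ : Env K) : RefSeg K → CType K → CType K → Prop where
  | array (i n : ℕ) (σ : CType K) : i < n → RefSegTyped Γ (.array i σ n) (.array σ n) σ
  | struct (i : ℕ) (t : String) (σ : CType K) :
      Γ.field t i = some σ → RefSegTyped Γ (.struct i t) (.struct t) σ
  | union (i : ℕ) (t : String) (q : Punning) (σ : CType K) :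
      Γ.field t i = some σ → RefSegTyped Γ (.union i t q) (.union t) σ

/-- `RefTyped Γ r τ σ`: `r` is a valid reference from `τ` to `σ`. -/
inductive RefTyped (Γ : Env K) : Ref K → CType K → CType K → Prop where
  | nil (τ : CType K) : RefTyped Γ [] τ τ
  | cons (s : RefSeg K) (r : Ref K) (τ σ ρ : CType K) :
      RefSegTyped Γ s τ σ → RefTyped Γ r σ ρ → RefTyped Γ (s :: r) τ ρ

/-- The array index selected by the last segment (and 0 if that is not an array segment). -/
def Ref.offset (r : Ref K) : ℕ :=
  match r.getLast? with
  | some (.array i _ _) => i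
  | _ => 0

/-- The array length in the last segment (and 1 if that is not an array segment). -/
def Ref.size (r : Ref K) : ℕ :=
  match r.getLast? with
  | some (.array _ _ n) => n
  | _ => 1

/-- Replace the array index in the last segment (if that is an array segment). -/
def Ref.setOffset (j : ℕ) (r : Ref K) : Ref K :=
  match r.getLast? with
  | some (.array _ τ n) => r.dropLast ++ [.array j τ n]
  | _ => r

/-- Memory typing environments: types of objects, with `true` for deallocated objects. -/
abbrev MemEnv (K : Type u) := Finmap (fun _ : Index => CType K × Bool)

def IndexTyped (Δ : MemEnv K) (o : Index) (τ : CType K) : Prop := ∃ β, Δ.lookup o = some (τ, β)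

def IndexAlive (Δ : MemEnv K) (o : Index) : Prop := ∃ τ, Δ.lookup o = some (τ, false)

def Ptr.Alive (Δ : MemEnv K) : Ptr K → Prop
  | .addr a => IndexAlive Δ a.idx
  | _ => True

/-- Byte addresses refer to individual bytes of a subobject. -/
def Addr.IsByte (a : Addr K) : Prop := PtrType.type a.subType ≠ a.ptrType

variable [LinearOrder K] (E : ImplEnv K) (Γ : Env K)

/-- `τ` is pointer castable to `σp`. -/
inductive PtrCastable : CType K → PtrType K → Prop where
  | self (τ : CType K) : PtrCastable τ (.type τ)
  | uchar (τ : CType K) : PtrCastable τ (.type (uchar E))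
  | any (τ : CType K) : PtrCastable τ .any

/-- The address refers to type `σp`. -/
inductive AddrTyped (Δ : MemEnv K) : Addr K → PtrType K → Prop where
  | mk (o : Index) (τ : CType K) (r : Ref K) (i : ℕ) (σ : CType K) (σp : PtrType K) :
      IndexTyped Δ o τ → TypeValid Γ τ → RefTyped Γ r τ σ → r.offset = 0 →
      i ≤ E.sizeOf Γ σ * r.size → ptrSize E Γ σp ∣ i → PtrCastable E σ σp →
      AddrTyped Δ ⟨o, τ, r, i, σ, σp⟩ σp

/-- The address is not an end-of-array address. -/
def Addr.Strict (a : Addr K) : Prop := a.off < E.sizeOf Γ a.subType * a.ref.size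

/-- The pointer refers to type `σp`. -/
inductive PtrTyped (Δ : MemEnv K) : Ptr K → PtrType K → Prop where
  | null (σp : PtrType K) : PtrTypeValid Γ σp → PtrTyped Δ (.null σp) σp
  | addr (a : Addr K) (σp : PtrType K) : AddrTyped E Γ Δ a σp → PtrTyped Δ (.addr a) σp
  | func (f : String) (τs : List (CType K)) (τ : CType K) :
      Γ.funs.lookup f = some (τs, τ) → PtrTyped Δ (.func f τs τ) (.func τs τ)

/-- The normalized reference. -/
def Addr.normRef (a : Addr K) : Ref K := a.ref.setOffset (a.off / E.sizeOf Γ a.subType)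

/-- The normalized byte offset. -/
def Addr.byteOff (a : Addr K) : ℕ := a.off % E.sizeOf Γ a.subType

end Refs

/-! ### Bits -/

/-- Bits: indeterminate, concrete, or the `i`th fragment of a pointer. -/
inductive Bit (K : Type u) where
  | indet : Bit K
  | bit : Bool → Bit K
  | ptr : Ptr K → ℕ → Bit K

/-- Permission annotated bits. -/
abbrev PBit (K : Type u) := Perm × Bit K

section Bits

variable {K : Type u}

def Bit.IsConcrete (b : Bit K) : Prop := ∃ β, b = .bit β

/-- The Boolean of a concrete bit (and a dummy value otherwise). -/
def Bit.toBool : Bit K → Bool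
  | .bit β => β
  | _ => false

open Classical in
/-- The join of two bits (with a dummy value if they are incompatible). -/
noncomputable def Bit.join (b c : Bit K) : Bit K :=
  if b = .indet then c else if c = .indet then b else if b = c then b else .indet

def PBit.indetify (b : PBit K) : PBit K := (b.1, .indet)

def PBit.Unmapped (b : PBit K) : Prop := b.1.Unmapped ∧ b.2 = .indet

def PBit.Unshared (b : PBit K) : Prop := b.1.Unshared

variable [LinearOrder K] (E : ImplEnv K) (Γ : Env K)

inductive BitValid (Δ : MemEnv K) : Bit K → Prop where
  | indet : BitValid Δ .indet
  | bit (β : Bool) : BitValid Δ (.bit β)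
  | ptr (p : Ptr K) (σp : PtrType K) (i : ℕ) :
      PtrTyped E Γ Δ p σp → p.Frozen → i < bitSize E Γ (.base (.ptr σp)) →
      BitValid Δ (.ptr p i)

def PBitValid (Δ : MemEnv K) (b : PBit K) : Prop :=
  BitValid E Γ Δ b.2 ∧ b.1.Valid ∧ (b.1.Unmapped → b.2 = .indet)

end Bits

/-! ### Memory trees -/

/-- Memory trees. In a structure each field comes with the padding after it. -/
inductive MTree (K : Type u) where
  | base : BaseType K → List (PBit K) → MTree K
  | array : CType K → List (MTree K) → MTree K
  | struct : String → List (MTree K × List (PBit K)) → MTree K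
  | union : String → ℕ → MTree K → List (PBit K) → MTree K
  | unionAll : String → List (PBit K) → MTree K

section Trees

variable {K : Type u}

theorem MTree.sizeOf_fst_lt {fs : List (MTree K × List (PBit K))}
    {f : MTree K × List (PBit K)} (h : f ∈ fs) : sizeOf f.1 < sizeOf fs := by
  have h1 := List.sizeOf_lt_of_mem h
  have h2 : sizeOf f = 1 + sizeOf f.1 + sizeOf f.2 := rfl
  omega

/-- Erase the tree structure. -/
def MTree.flatten : MTree K → List (PBit K)
  | .base _ bs => bs
  | .array _ ws => ws.flatMap fun w => w.flatten
  | .struct _ fs => fs.flatMap fun f => f.1.flatten ++ f.2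
  | .union _ _ w bs => w.flatten ++ bs
  | .unionAll _ bs => bs
decreasing_by
  all_goals simp_wf
  all_goals first
    | omega
    | (have := List.sizeOf_lt_of_mem ‹_ ∈ _›; omega)
    | (have := MTree.sizeOf_fst_lt ‹_ ∈ _›; omega)

def MTree.typeOf : MTree K → CType K
  | .base τb _ => .base τb
  | .array τ ws => .array τ ws.length
  | .struct t _ => .struct t
  | .union t _ _ _ => .union t
  | .unionAll t _ => .union t

variable [LinearOrder K] (E : ImplEnv K) (Γ : Env K)

/-- The memory tree has the given type. -/
inductive MTreeTyped (Δ : MemEnv K) : MTree K → CType K → Prop where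
  | base (τb : BaseType K) (bs : List (PBit K)) :
      BaseTypeValid Γ τb → (∀ b ∈ bs, PBitValid E Γ Δ b) →
      bs.length = bitSize E Γ (.base τb) → MTreeTyped Δ (.base τb bs) (.base τb)
  | array (τ : CType K) (ws : List (MTree K)) :
      (∀ w ∈ ws, MTreeTyped Δ w τ) → ws.length ≠ 0 →
      MTreeTyped Δ (.array τ ws) (.array τ ws.length)
  | struct (t : String) (fs : List (MTree K × List (PBit K))) (τs : List (CType K)) :
      Γ.fields t = some τs → fs.length = τs.length →
      (∀ (i : ℕ) (w : MTree K) (bs : List (PBit K)) (τ : CType K),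
        fs[i]? = some (w, bs) → τs[i]? = some τ → MTreeTyped Δ w τ) →
      (∀ (i : ℕ) (w : MTree K) (bs : List (PBit K)) (τ : CType K) (z : ℕ),
        fs[i]? = some (w, bs) → τs[i]? = some τ →
        (fieldBitSizes E Γ τs)[i]? = some z →
        (∀ b ∈ bs, PBitValid E Γ Δ b ∧ b.2 = .indet) ∧ bs.length = z - bitSize E Γ τ) →
      MTreeTyped Δ (.struct t fs) (.struct t)
  | union (t : String) (i : ℕ) (w : MTree K) (bs : List (PBit K)) (τ : CType K) :
      Γ.field t i = some τ → MTreeTyped Δ w τ →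
      (∀ b ∈ bs, PBitValid E Γ Δ b ∧ b.2 = .indet) →
      bitSize E Γ (.union t) = bitSize E Γ τ + bs.length →
      ¬ (∀ b ∈ w.flatten ++ bs, PBit.Unmapped b) →
      MTreeTyped Δ (.union t i w bs) (.union t)
  | unionAll (t : String) (bs : List (PBit K)) :
      t ∈ Γ.compounds → (∀ b ∈ bs, PBitValid E Γ Δ b) →
      bs.length = bitSize E Γ (.union t) → MTreeTyped Δ (.unionAll t bs) (.union t)

/-- Interpret a sequence of bits as a memory tree of the given type. -/
def mtreeUnflatten : CType K → List (PBit K) → MTree K :=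
  typeRec Γ
    (fun τb bs => .base τb bs)
    (fun τ n f bs => .array τ (((List.replicate n (bitSize E Γ τ)).splitLengths bs).map f))
    (fun t fs bs => .struct t (List.zipWith
      (fun f p => (f.2 (p.take (bitSize E Γ f.1)),
        (p.drop (bitSize E Γ f.1)).map PBit.indetify))
      fs ((fieldBitSizes E Γ (fs.map Prod.fst)).splitLengths bs)))
    (fun t _ bs => .unionAll t bs)

open Classical in
/-- The subtree at a reference. -/
noncomputable def mtreeLookup : Ref K → MTree K → Option (MTree K)
  | [], w => some w
  | .array i τ _ :: r, .array τ' ws =>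
      if τ = τ' then ws[i]?.bind (mtreeLookup r) else none
  | .struct i t :: r, .struct t' fs =>
      if t = t' then fs[i]?.bind (fun f => mtreeLookup r f.1) else none
  | .union i t q :: r, .union t' j w bs =>
      if t = t' then
        if i = j then mtreeLookup r w
        else if q = .unfrozen ∧ ∀ b ∈ w.flatten ++ bs, PBit.Unshared b then
          (Γ.field t i).bind fun τ =>
            mtreeLookup r (mtreeUnflatten E Γ τ ((w.flatten ++ bs).take (bitSize E Γ τ)))
        else none
      else none
  | .union i t _ :: r, .unionAll t' bs =>
      if t = t' ∧ ∀ b ∈ bs, PBit.Unshared b then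
        (Γ.field t i).bind fun τ =>
          mtreeLookup r (mtreeUnflatten E Γ τ (bs.take (bitSize E Γ τ)))
      else none
  | _, _ => none

open Classical in
/-- Apply `f` to the subtree at a reference; unions on the path get the variant that is
selected by the reference. The result is only meaningful where the lookup succeeds. -/
noncomputable def mtreeAlter (f : MTree K → MTree K) : Ref K → MTree K → MTree K
  | [], w => f w
  | .array i _ _ :: r, .array τ ws => .array τ (ws.modify i (mtreeAlter f r))
  | .struct i _ :: r, .struct t fs =>
      .struct t (fs.modify i fun p => (mtreeAlter f r p.1, p.2))
  | .union i _ _ :: r, .union t j w bs =>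
      if i = j then .union t i (mtreeAlter f r w) bs
      else match Γ.field t i with
        | some τ => .union t i
            (mtreeAlter f r (mtreeUnflatten E Γ τ ((w.flatten ++ bs).take (bitSize E Γ τ))))
            (((w.flatten ++ bs).drop (bitSize E Γ τ)).map PBit.indetify)
        | none => .union t j w bs
  | .union i _ _ :: r, .unionAll t bs =>
      match Γ.field t i with
      | some τ => .union t i
          (mtreeAlter f r (mtreeUnflatten E Γ τ (bs.take (bitSize E Γ τ))))
          ((bs.drop (bitSize E Γ τ)).map PBit.indetify)
      | none => .unionAll t bs
  | _, w => w

end Trees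

/-! ### Memories -/

/-- An entry of the memory: a deallocated object, of which only the type is kept, or a live object
with a flag telling whether it was obtained by `malloc`. -/
inductive MemObj (K : Type u) where
  | freed : CType K → MemObj K
  | obj : MTree K → Bool → MemObj K

/-- Memories. -/
abbrev Mem (K : Type u) := Finmap (fun _ : Index => MemObj K)

section Memory

variable {K : Type u} [LinearOrder K] (E : ImplEnv K) (Γ : Env K)

/-- The memory `m` is valid with respect to the memory typing environment `Δ`. -/
def MemValid (Δ : MemEnv K) (m : Mem K) : Prop :=
  (∀ o τ, m.lookup o = some (.freed τ) →
    IndexTyped Δ o τ ∧ ¬ IndexAlive Δ o ∧ TypeValid Γ τ) ∧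
  (∀ o w μ, m.lookup o = some (.obj w μ) → ∃ τ,
    IndexTyped Δ o τ ∧ IndexAlive Δ o ∧ MTreeTyped E Γ Δ w τ ∧
      ¬ (∀ b ∈ w.flatten, b = (Perm.empty, Bit.indet)))

/-- The bits from byte `i` to byte `i + 1`. -/
def byteSlice {α : Type v} (i : ℕ) (bs : List α) : List α :=
  (bs.drop (i * E.charBits)).take E.charBits

open Classical in
/-- The memory tree at an address; this fails for end-of-array addresses. -/
noncomputable def cmapLookup (a : Addr K) (m : Mem K) : Option (MTree K) :=
  match m.lookup a.idx with
  | some (.obj w _) =>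
      if a.Strict E Γ then
        (mtreeLookup E Γ (a.normRef E Γ) w).map fun w' =>
          if a.IsByte then
            mtreeUnflatten E Γ (uchar E) (byteSlice E (a.byteOff E Γ) w'.flatten)
          else w'
      else none
  | _ => none

/-- Apply `f` to the `i`th byte of a memory tree. -/
def alterByte (f : MTree K → MTree K) (i : ℕ) (w : MTree K) : MTree K :=
  mtreeUnflatten E Γ w.typeOf
    (w.flatten.take (i * E.charBits) ++
      (f (mtreeUnflatten E Γ (uchar E) (byteSlice E i w.flatten))).flatten ++
      w.flatten.drop ((i + 1) * E.charBits))

open Classical in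
/-- Apply `f` to the memory tree at an address. -/
noncomputable def cmapAlter (f : MTree K → MTree K) (a : Addr K) (m : Mem K) : Mem K :=
  match m.lookup a.idx with
  | some (.obj w μ) =>
      m.insert a.idx (.obj
        (mtreeAlter E Γ (if a.IsByte then alterByte E Γ f (a.byteOff E Γ) else f)
          (a.normRef E Γ) w) μ)
  | _ => m

end Memory

/-! ### Values -/

/-- Base values. -/
inductive BaseVal (K : Type u) where
  | indet : BaseType K → BaseVal K
  | void : BaseVal K
  | int : IntType K → ℤ → BaseVal K
  | ptr : Ptr K → BaseVal K
  | byte : List (Bit K) → BaseVal K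

/-- Abstract values. -/
inductive Val (K : Type u) where
  | base : BaseVal K → Val K
  | array : CType K → List (Val K) → Val K
  | struct : String → List (Val K) → Val K
  | union : String → ℕ → Val K → Val K
  | unionAll : String → List (Val K) → Val K

section Values

variable {K : Type u} [LinearOrder K] (E : ImplEnv K) (Γ : Env K)

/-- The base value has the given base type. -/
inductive BaseValTyped (Δ : MemEnv K) : BaseVal K → BaseType K → Prop where
  | indet (τb : BaseType K) : BaseTypeValid Γ τb → τb ≠ .void → BaseValTyped Δ (.indet τb) τb
  | void : BaseValTyped Δ .void .void
  | int (x : ℤ) (τi : IntType K) :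
      IntTyped E.toIntEnv x τi → BaseValTyped Δ (.int τi x) (.int τi)
  | ptr (p : Ptr K) (σp : PtrType K) : PtrTyped E Γ Δ p σp → BaseValTyped Δ (.ptr p) (.ptr σp)
  | byte (bs : List (Bit K)) :
      (∀ b ∈ bs, BitValid E Γ Δ b) → bs.length = E.charBits →
      ¬ (∀ b ∈ bs, b.IsConcrete) → ¬ (∀ b ∈ bs, b = .indet) →
      BaseValTyped Δ (.byte bs) (.int (ucharInt E))

def BaseVal.typeOf : BaseVal K → BaseType K
  | .indet τb => τb
  | .void => .void
  | .int τi _ => .int τi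
  | .ptr p => .ptr p.typeOf
  | .byte _ => .int (ucharInt E)

/-- The fragments of a pointer of type `σp`. -/
def ptrBits (σp : PtrType K) (p : Ptr K) : List (Bit K) :=
  (List.range (bitSize E Γ (.base (.ptr σp)))).map fun i => Bit.ptr p i

/-- The bit representation of a base value; pointers become frozen. -/
def BaseVal.flatten : BaseVal K → List (Bit K)
  | .indet τb => List.replicate (bitSize E Γ (.base τb)) .indet
  | .void => List.replicate (bitSize E Γ (.base .void)) .indet
  | .int τi x => (intToBits E.toIntEnv τi x).map Bit.bit
  | .ptr p => ptrBits E Γ p.typeOf p.freeze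
  | .byte bs => bs

open Classical in
/-- Interpret a sequence of bits as a base value. -/
noncomputable def baseValUnflatten : BaseType K → List (Bit K) → BaseVal K
  | .void, _ => .void
  | .int τi, bs =>
      if ∀ b ∈ bs, b.IsConcrete then .int τi (intOfBits E.toIntEnv τi (bs.map Bit.toBool))
      else if τi = ucharInt E ∧ ¬ (∀ b ∈ bs, b = .indet) then .byte bs
      else .indet (.int τi)
  | .ptr σp, bs =>
      if h : ∃ p : Ptr K, bs = ptrBits E Γ σp p ∧ p.typeOf = σp then .ptr h.choose
      else .indet (.ptr σp)

/-- Interpret a sequence of bits as a value of the given type. -/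
noncomputable def valUnflatten : CType K → List (Bit K) → Val K :=
  typeRec Γ
    (fun τb bs => .base (baseValUnflatten E Γ τb bs))
    (fun τ n f bs => .array τ (((List.replicate n (bitSize E Γ τ)).splitLengths bs).map f))
    (fun t fs bs => .struct t (List.zipWith
      (fun f p => f.2 (p.take (bitSize E Γ f.1)))
      fs ((fieldBitSizes E Γ (fs.map Prod.fst)).splitLengths bs)))
    (fun t fs bs => .unionAll t (fs.map fun f => f.2 (bs.take (bitSize E Γ f.1))))

/-- The values `vs` of types `τs` are the interpretations of one common bit representation of the
union `t`. -/
def Representable (Δ : MemEnv K) (t : String) (vs : List (Val K)) (τs : List (CType K)) : Prop :=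
  ∃ bs : List (Bit K), (∀ b ∈ bs, BitValid E Γ Δ b) ∧ bs.length = bitSize E Γ (.union t) ∧
    vs = τs.map fun τ => valUnflatten E Γ τ (bs.take (bitSize E Γ τ))

/-- The value has the given type. -/
inductive ValTyped (Δ : MemEnv K) : Val K → CType K → Prop where
  | base (vb : BaseVal K) (τb : BaseType K) :
      BaseValTyped E Γ Δ vb τb → ValTyped Δ (.base vb) (.base τb)
  | array (τ : CType K) (vs : List (Val K)) :
      (∀ v ∈ vs, ValTyped Δ v τ) → vs.length ≠ 0 →
      ValTyped Δ (.array τ vs) (.array τ vs.length)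
  | struct (t : String) (vs : List (Val K)) (τs : List (CType K)) :
      Γ.fields t = some τs → vs.length = τs.length →
      (∀ (i : ℕ) (v : Val K) (τ : CType K), vs[i]? = some v → τs[i]? = some τ → ValTyped Δ v τ) →
      ValTyped Δ (.struct t vs) (.struct t)
  | union (t : String) (i : ℕ) (v : Val K) (τ : CType K) :
      Γ.field t i = some τ → ValTyped Δ v τ → ValTyped Δ (.union t i v) (.union t)
  | unionAll (t : String) (vs : List (Val K)) (τs : List (CType K)) :
      Γ.fields t = some τs → vs.length = τs.length →
      (∀ (i : ℕ) (v : Val K) (τ : CType K), vs[i]? = some v → τs[i]? = some τ → ValTyped Δ v τ) →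
      Representable E Γ Δ t vs τs → ValTyped Δ (.unionAll t vs) (.union t)

def Val.typeOf : Val K → CType K
  | .base vb => .base (vb.typeOf E)
  | .array τ vs => .array τ vs.length
  | .struct t _ => .struct t
  | .union t _ _ => .union t
  | .unionAll t _ => .union t

/-- The bit representation of a value; padding is indeterminate, and the common representation of
all variants of a union is the join of their representations. -/
noncomputable def Val.flatten : Val K → List (Bit K)
  | .base vb => vb.flatten E Γ
  | .array _ vs => (vs.map fun v => v.flatten).flatten
  | .struct t vs => (List.zipWith (fun z bs => List.takeD z bs .indet)
      (fieldBitSizes E Γ ((Γ.fields t).getD [])) (vs.map fun v => v.flatten)).flatten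
  | .union t _ v => List.takeD (bitSize E Γ (.union t)) v.flatten .indet
  | .unionAll t vs => (vs.map fun v => v.flatten).foldr
      (fun bs cs => List.zipWith Bit.join (List.takeD (bitSize E Γ (.union t)) bs .indet) cs)
      (List.replicate (bitSize E Γ (.union t)) .indet)

/-- Convert a value into a memory tree whose bits have the given permissions. -/
noncomputable def ofVal : Val K → List Perm → MTree K
  | .base vb, γs => .base (vb.typeOf E) (γs.zip (vb.flatten E Γ))
  | .array τ vs, γs => .array τ (List.zipWith (fun g p => g p) (vs.map fun v => ofVal v)
      ((List.replicate vs.length (bitSize E Γ τ)).splitLengths γs))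
  | .struct t vs, γs =>
      let τs := (Γ.fields t).getD []
      .struct t (List.zipWith
        (fun g (q : CType K × List Perm) => (g (q.2.take (bitSize E Γ q.1)),
          (q.2.drop (bitSize E Γ q.1)).map fun γ => (γ, Bit.indet)))
        (vs.map fun v => ofVal v)
        (τs.zip ((fieldBitSizes E Γ τs).splitLengths γs)))
  | .union t i v, γs =>
      let s := bitSize E Γ (v.typeOf E)
      .union t i (ofVal v (γs.take s))
        (((γs.take (bitSize E Γ (.union t))).drop s).map fun γ => (γ, Bit.indet))
  | .unionAll t vs, γs => .unionAll t (γs.zip ((Val.unionAll t vs).flatten E Γ))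

/-- Convert a memory tree into a value. -/
noncomputable def toVal : MTree K → Val K
  | .base τb bs => .base (baseValUnflatten E Γ τb (bs.map Prod.snd))
  | .array τ ws => .array τ (ws.map fun w => toVal w)
  | .struct t fs => .struct t (fs.map fun f => toVal f.1)
  | .union t i w _ => .union t i (toVal w)
  | .unionAll t bs => valUnflatten E Γ (.union t) (bs.map Prod.snd)
decreasing_by
  all_goals simp_wf
  all_goals first
    | omega
    | (have := List.sizeOf_lt_of_mem ‹_ ∈ _›; omega)
    | (have := MTree.sizeOf_fst_lt ‹_ ∈ _›; omega)

/-! ### Memory operations -/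

open Classical in
/-- The value at address `a`; this fails if it cannot be accessed or is not readable. -/
noncomputable def memLookup (a : Addr K) (m : Mem K) : Option (Val K) :=
  (cmapLookup E Γ a m).bind fun w =>
    if ∀ b ∈ w.flatten, KindLE (some .readable) b.1.kind then some (toVal E Γ w) else none

/-- Store the value `v` at address `a`, keeping the permissions. -/
noncomputable def memInsert (a : Addr K) (v : Val K) (m : Mem K) : Mem K :=
  cmapAlter E Γ (fun w => ofVal E Γ v (w.flatten.map Prod.fst)) a m

/-- Storing at address `a` is permitted. -/
def MemWritable (a : Addr K) (m : Mem K) : Prop :=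
  ∃ w, cmapLookup E Γ a m = some w ∧ ∀ b ∈ w.flatten, KindLE (some .writable) b.1.kind

end Values

/-! ### Refinements -/

/-- Renaming functions: they map an object to a subobject of an object. -/
abbrev MemInj (K : Type u) := Index → Option (Index × Ref K)

/-- The identity renaming. -/
def memInjId {K : Type u} : MemInj K := fun o => some (o, [])

section Refinement

variable {K : Type u}

/-- Frozen union annotations may be replaced by unfrozen ones. -/
inductive RefSegRefine : RefSeg K → RefSeg K → Prop where
  | refl (s : RefSeg K) : RefSegRefine s s
  | thaw (i : ℕ) (t : String) : RefSegRefine (.union i t .frozen) (.union i t .unfrozen)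

variable [LinearOrder K] (E : ImplEnv K) (Γ : Env K) (f : MemInj K) (Δ₁ Δ₂ : MemEnv K)

/-- The address is renamed according to `f`, possibly with some union annotations unfrozen. If the
source refers to a whole object that becomes an array element, then the target is expressed
relative to the first element of that array. -/
inductive AddrRefine : Addr K → Addr K → PtrType K → Prop where
  | mk (o₁ o₂ : Index) (τ₁ τ₂ : CType K) (r r₁ r₂ : Ref K) (i : ℕ) (σ : CType K)
      (σp : PtrType K) :
      f o₁ = some (o₂, r) → AddrTyped E Γ Δ₁ ⟨o₁, τ₁, r₁, i, σ, σp⟩ σp →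
      IndexTyped Δ₂ o₂ τ₂ → TypeValid Γ τ₂ → RefTyped Γ r τ₂ τ₁ →
      List.Forall₂ RefSegRefine (Ref.setOffset 0 (r ++ r₁)) r₂ →
      AddrRefine ⟨o₁, τ₁, r₁, i, σ, σp⟩
        ⟨o₂, τ₂, r₂, i + E.sizeOf Γ σ * Ref.offset (r ++ r₁), σ, σp⟩ σp

inductive PtrRefine : Ptr K → Ptr K → PtrType K → Prop where
  | null (σp : PtrType K) : PtrTypeValid Γ σp → PtrRefine (.null σp) (.null σp) σp
  | addr (a₁ a₂ : Addr K) (σp : PtrType K) :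
      AddrRefine E Γ f Δ₁ Δ₂ a₁ a₂ σp → PtrRefine (.addr a₁) (.addr a₂) σp
  | func (g : String) (τs : List (CType K)) (τ : CType K) :
      Γ.funs.lookup g = some (τs, τ) → PtrRefine (.func g τs τ) (.func g τs τ) (.func τs τ)

/-- Indeterminate bits and fragments of deallocated pointers may be replaced by arbitrary bits. -/
inductive BitRefine : Bit K → Bit K → Prop where
  | bit (β : Bool) : BitRefine (.bit β) (.bit β)
  | ptr (p₁ p₂ : Ptr K) (σp : PtrType K) (i : ℕ) :
      PtrRefine E Γ f Δ₁ Δ₂ p₁ p₂ σp → p₂.Frozen → i < bitSize E Γ (.base (.ptr σp)) →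
      BitRefine (.ptr p₁ i) (.ptr p₂ i)
  | indet (b : Bit K) : BitValid E Γ Δ₂ b → BitRefine .indet b
  | dead (a : Addr K) (σp : PtrType K) (i : ℕ) (b : Bit K) :
      AddrTyped E Γ Δ₁ a σp → ¬ IndexAlive Δ₁ a.idx → BitValid E Γ Δ₂ b →
      BitRefine (.ptr (.addr a) i) b

/-- Refinement of base values: integers are kept, pointers and bytes are refined, indeterminate
values and deallocated pointers may be replaced by arbitrary values of the same type. -/
inductive BaseValRefine : BaseVal K → BaseVal K → BaseType K → Prop where
  | indet (vb : BaseVal K) (τb : BaseType K) :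
      τb ≠ .void → BaseValTyped E Γ Δ₂ vb τb → BaseValRefine (.indet τb) vb τb
  | void : BaseValRefine .void .void .void
  | int (x : ℤ) (τi : IntType K) :
      IntTyped E.toIntEnv x τi → BaseValRefine (.int τi x) (.int τi x) (.int τi)
  | ptr (p₁ p₂ : Ptr K) (σp : PtrType K) :
      PtrRefine E Γ f Δ₁ Δ₂ p₁ p₂ σp → BaseValRefine (.ptr p₁) (.ptr p₂) (.ptr σp)
  | dead (a : Addr K) (vb : BaseVal K) (σp : PtrType K) :
      AddrTyped E Γ Δ₁ a σp → ¬ IndexAlive Δ₁ a.idx → BaseValTyped E Γ Δ₂ vb (.ptr σp) →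
      BaseValRefine (.ptr (.addr a)) vb (.ptr σp)
  | byte (bs : List (Bit K)) (vb : BaseVal K) :
      BaseValTyped E Γ Δ₁ (.byte bs) (.int (ucharInt E)) →
      BaseValTyped E Γ Δ₂ vb (.int (ucharInt E)) →
      List.Forall₂ (BitRefine E Γ f Δ₁ Δ₂) bs (vb.flatten E Γ) →
      BaseValRefine (.byte bs) vb (.int (ucharInt E))

/-- Refinement of values: base values are refined along the structure of the value, and a union
with a specified variant may be replaced by a union with an unspecified variant. -/
inductive ValRefine : Val K → Val K → CType K → Prop where
  | base (vb₁ vb₂ : BaseVal K) (τb : BaseType K) :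
      BaseValRefine E Γ f Δ₁ Δ₂ vb₁ vb₂ τb → ValRefine (.base vb₁) (.base vb₂) (.base τb)
  | array (τ : CType K) (vs₁ vs₂ : List (Val K)) :
      vs₁.length ≠ 0 → vs₁.length = vs₂.length →
      (∀ (i : ℕ) (v₁ v₂ : Val K), vs₁[i]? = some v₁ → vs₂[i]? = some v₂ → ValRefine v₁ v₂ τ) →
      ValRefine (.array τ vs₁) (.array τ vs₂) (.array τ vs₁.length)
  | struct (t : String) (τs : List (CType K)) (vs₁ vs₂ : List (Val K)) :
      Γ.fields t = some τs → vs₁.length = τs.length → vs₂.length = τs.length →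
      (∀ (i : ℕ) (v₁ v₂ : Val K) (τ : CType K),
        vs₁[i]? = some v₁ → vs₂[i]? = some v₂ → τs[i]? = some τ →
        ValRefine v₁ v₂ τ) →
      ValRefine (.struct t vs₁) (.struct t vs₂) (.struct t)
  | union (t : String) (i : ℕ) (τ : CType K) (v₁ v₂ : Val K) :
      Γ.field t i = some τ → ValRefine v₁ v₂ τ →
      ValRefine (.union t i v₁) (.union t i v₂) (.union t)
  | unionAll (t : String) (τs : List (CType K)) (vs₁ vs₂ : List (Val K)) :
      Γ.fields t = some τs → vs₁.length = τs.length → vs₂.length = τs.length →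
      (∀ (i : ℕ) (v₁ v₂ : Val K) (τ : CType K),
        vs₁[i]? = some v₁ → vs₂[i]? = some v₂ → τs[i]? = some τ →
        ValRefine v₁ v₂ τ) →
      Representable E Γ Δ₁ t vs₁ τs → Representable E Γ Δ₂ t vs₂ τs →
      ValRefine (.unionAll t vs₁) (.unionAll t vs₂) (.union t)
  | union_unionAll (t : String) (i : ℕ) (τs : List (CType K)) (τ : CType K) (v₁ v₂ : Val K)
      (vs₂ : List (Val K)) :
      Γ.fields t = some τs → τs[i]? = some τ → vs₂[i]? = some v₂ → ValRefine v₁ v₂ τ →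
      ValTyped E Γ Δ₂ (.unionAll t vs₂) (.union t) →
      ValRefine (.union t i v₁) (.unionAll t vs₂) (.union t)

end Refinement
end CH2O

/-! A store replaces the tree at the address `a` by the representation of `v`, and it gives the
unions on the path to `a` the variants that the path selects. A subsequent lookup therefore follows
the path without type-punning (`mtreeLookup_mtreeAlter`) and finds exactly the new tree. Its
permissions are old ones, hence writable and in particular readable, so the lookup yields the value
read back from that tree. It remains to compare this value with `v`.

The comparison rests on the information order `Bit.Le`, in which the indeterminate bit is the least
element. Reading back the representation of a base value gives the value itself with its pointers
frozen, and gives a value that refines to it if some bits have become indeterminate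
(`BaseValTyped.baseValUnflatten_refine`). This extends along the structure of values
(`ValTyped.toVal_ofVal_refine`), the interesting case being that of a union `v` of unspecified
variant. Its components are the interpretations of some common bits `bs`, but what is stored is the
join of the representations of the components. Every component represents no more information than
`bs` (`flatten_valUnflatten_le`), hence neither does the join, and interpreting bits as a value is
monotone with respect to the information order and refinement (`valUnflatten_mono`).

If `a` is a byte address, then the tree of the whole subobject is rebuilt from its bits with one
byte replaced. Rebuilding makes padding indeterminate but keeps all other bits and all permissions
(`flatten_mtreeUnflatten_le`), so the byte read back is below the stored one in the information
order, and the result on base values applies again. -/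

namespace CH2O

/-! ### Integer coding -/

/-- The lowest `N` two's complement bits of `x` encode the residue of `x` modulo `2 ^ N`. -/
theorem natOfBits_map_testBit (N : ℕ) (x : ℤ) :
    (natOfBits ((List.range N).map fun i => x.testBit i) : ℤ) = x % 2 ^ N := by
  induction N generalizing x with
  | zero => simp [natOfBits]
  | succ N ih =>
    obtain ⟨b, n, rfl⟩ : ∃ b n, x = Int.bit b n := ⟨_, _, (Int.bit_decomp x).symm⟩
    rw [List.range_succ_eq_map, List.map_cons, List.map_map]
    have h : ((fun i => (Int.bit b n).testBit i) ∘ Nat.succ) = fun i => n.testBit i := by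
      funext i
      exact Int.testBit_bit_succ i b n
    rw [h, natOfBits, Int.testBit_bit_zero]
    push_cast
    rw [ih, Int.bit_val, pow_succ']
    have h2 : 0 ≤ n % 2 ^ N := Int.emod_nonneg _ (by positivity)
    have h3 : n % 2 ^ N < 2 ^ N := Int.emod_lt_of_pos _ (by positivity)
    have h4 : 2 * n + cond b 1 0 = (b.toNat : ℤ) + 2 * (n % 2 ^ N) + 2 * 2 ^ N * (n / 2 ^ N) := by
      have := Int.emod_add_mul_ediv n (2 ^ N)
      cases b <;> simp <;> linarith
    rw [h4, Int.add_mul_emod_self_left]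
    refine (Int.emod_eq_of_lt (by positivity) ?_).symm
    cases b <;> simp <;> omega

theorem natOfBits_lt (β : List Bool) : natOfBits β < 2 ^ β.length := by
  induction β with
  | nil => simp [natOfBits]
  | cons b β ih =>
    simp only [natOfBits, List.length_cons, pow_succ']
    cases b <;> simp <;> omega

theorem natOfBits_append_singleton (β : List Bool) (b : Bool) :
    natOfBits (β ++ [b]) = natOfBits β + 2 ^ β.length * b.toNat := by
  induction β with
  | nil => simp [natOfBits]
  | cons c β ih =>
    simp only [List.cons_append, natOfBits, ih, List.length_cons, pow_succ']
    ring

theorem natOfBits_injective {β β' : List Bool} (hl : β.length = β'.length)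
    (h : natOfBits β = natOfBits β') : β = β' := by
  induction β generalizing β' with
  | nil => exact (List.length_eq_zero_iff.1 hl.symm).symm
  | cons b β ih =>
    cases β' with
    | nil => simp at hl
    | cons b' β' =>
      simp only [natOfBits] at h
      have hb : b = b' := by
        cases b <;> cases b' <;> first | rfl | (simp at h; omega)
      subst hb
      rw [ih (by simpa using hl) (by omega)]

/-- The value of a nonempty list of bits lies in the upper half of the range iff the
most significant bit is set. -/
theorem getLastD_eq_true_iff {β : List Bool} (hβ : β ≠ []) :
    β.getLastD false = true ↔ 2 ^ (β.length - 1) ≤ natOfBits β := by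
  obtain ⟨β, b, rfl⟩ := (List.eq_nil_or_concat' β).resolve_left hβ
  have h := natOfBits_lt β
  rw [natOfBits_append_singleton]
  cases b <;> simp [List.getLastD_eq_getLast?]
  exact h

section IntCoding

variable {K : Type*} [LinearOrder K] (E : IntEnv K)

theorem IntEnv.bits_pos (k : K) : 0 < E.charBits * E.rankSize k :=
  Nat.mul_pos (by have := E.charBits_ge; omega) (E.rankSize_pos k)

theorem length_deendianize (k : K) (l : List Bool) : (E.deendianize k l).length = l.length := by
  conv_rhs => rw [← E.endianize_deendianize k l]
  exact (E.endianize_perm k _).length_eq.symm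

theorem length_intToBits (τi : IntType K) (x : ℤ) :
    (intToBits E τi x).length = E.charBits * E.rankSize τi.rank := by
  simp [intToBits, (E.endianize_perm _ _).length_eq]

theorem intOfBits_intToBits {x : ℤ} {τi : IntType K} (h : IntTyped E x τi) :
    intOfBits E τi (intToBits E τi x) = x := by
  obtain ⟨s, k⟩ := τi
  have hN := E.bits_pos k
  have hmod := natOfBits_map_testBit (E.charBits * E.rankSize k) x
  simp only [intOfBits, intToBits, E.deendianize_endianize]
  cases s with
  | unsigned =>
    simp only [IntTyped] at h
    simp only [hmod]
    exact Int.emod_eq_of_lt h.1 h.2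
  | signed =>
    simp only [IntTyped] at h
    generalize E.charBits * E.rankSize k = N at *
    obtain ⟨M, rfl⟩ : ∃ M, N = M + 1 := ⟨N - 1, by omega⟩
    have hlast := getLastD_eq_true_iff
      (β := (List.range (M + 1)).map fun i => x.testBit i) (by simp)
    simp only [List.length_map, List.length_range, Nat.add_sub_cancel] at hlast h ⊢
    zify at hlast
    rw [hmod] at hlast
    simp only [hmod, hlast]
    have h2 : (2 : ℤ) ^ (M + 1) = 2 * 2 ^ M := pow_succ' _ _
    rw [h2]
    by_cases hx : 0 ≤ x
    · rw [Int.emod_eq_of_lt hx (by omega), if_neg (by omega)]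
    · have h3 : x % (2 * 2 ^ M) = x + 2 * 2 ^ M := by
        rw [← Int.add_emod_right, Int.emod_eq_of_lt (by omega) (by omega)]
      rw [h3, if_pos (by omega)]
      ring

/-- Decoding a list of bits gives the unsigned reading up to a multiple of `2 ^ N`. -/
theorem intOfBits_emod {τi : IntType K} {l : List Bool} :
    intOfBits E τi l % 2 ^ l.length = natOfBits (E.deendianize τi.rank l) := by
  have hlt := natOfBits_lt (E.deendianize τi.rank l)
  have hl := length_deendianize E τi.rank l
  rw [hl] at hlt
  have hmod : (natOfBits (E.deendianize τi.rank l) : ℤ) % 2 ^ l.length =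
      natOfBits (E.deendianize τi.rank l) :=
    Int.emod_eq_of_lt (by positivity) (by exact_mod_cast hlt)
  unfold intOfBits
  simp only [hl]
  split
  · exact hmod
  · split
    · rw [Int.sub_emod_right, hmod]
    · exact hmod

/-- Both lists of bits have the same residue as unsigned numbers, so they agree. -/
theorem intToBits_intOfBits {τi : IntType K} {l : List Bool}
    (hl : l.length = E.charBits * E.rankSize τi.rank) :
    intToBits E τi (intOfBits E τi l) = l := by
  have h := natOfBits_map_testBit (E.charBits * E.rankSize τi.rank) (intOfBits E τi l)
  rw [← hl, intOfBits_emod] at h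
  rw [intToBits, ← hl, natOfBits_injective _ (Int.ofNat_inj.1 h), E.endianize_deendianize]
  simp [length_deendianize]

theorem intTyped_intOfBits {τi : IntType K} {l : List Bool}
    (hl : l.length = E.charBits * E.rankSize τi.rank) :
    IntTyped E (intOfBits E τi l) τi := by
  obtain ⟨s, k⟩ := τi
  have hN := E.bits_pos k
  have hlt := natOfBits_lt (E.deendianize k l)
  have hlen := length_deendianize E k l
  simp only at hl
  rw [hlen, hl] at hlt
  have hlt' : (natOfBits (E.deendianize k l) : ℤ) < 2 ^ (E.charBits * E.rankSize k) := by
    exact_mod_cast hlt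
  cases s with
  | unsigned =>
    simp only [IntTyped, intOfBits]
    exact ⟨by positivity, hlt'⟩
  | signed =>
    have hlast := getLastD_eq_true_iff (β := E.deendianize k l)
      (by rw [← List.length_pos_iff]; omega)
    simp only [IntTyped, intOfBits, hlen, hl] at hlast ⊢
    generalize E.charBits * E.rankSize k = N at *
    obtain ⟨M, rfl⟩ : ∃ M, N = M + 1 := ⟨N - 1, by omega⟩
    zify at hlast
    simp only [hlast, Nat.add_sub_cancel] at hlast ⊢
    have h2 : (2 : ℤ) ^ (M + 1) = 2 * 2 ^ M := pow_succ' _ _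
    rw [h2] at hlt' ⊢
    split <;> omega

end IntCoding

/-! ### Types of well-formed environments -/

section Types

variable {K : Type*}

mutual
theorem PtrTypeValid.weaken {Γ Γ' : Env K} (h : ∀ t, t ∈ Γ.compounds → t ∈ Γ'.compounds)
    {τp : PtrType K} : PtrTypeValid Γ τp → PtrTypeValid Γ' τp
  | .any => .any
  | .func τs τ h1 h2 =>
      .func τs τ (fun σ hσ => (h1 σ hσ).weaken h) (h2.weaken h)
  | .base τb h1 => .base τb (h1.weaken h)
  | .array τ n h1 hn => .array τ n (h1.weaken h) hn
  | .struct t => .struct t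
  | .union t => .union t
theorem BaseTypeValid.weaken {Γ Γ' : Env K} (h : ∀ t, t ∈ Γ.compounds → t ∈ Γ'.compounds)
    {τb : BaseType K} : BaseTypeValid Γ τb → BaseTypeValid Γ' τb
  | .int τi => .int τi
  | .ptr τp h1 => .ptr τp (h1.weaken h)
  | .void => .void
theorem TypeValid.weaken {Γ Γ' : Env K} (h : ∀ t, t ∈ Γ.compounds → t ∈ Γ'.compounds)
    {τ : CType K} : TypeValid Γ τ → TypeValid Γ' τ
  | .base τb h1 => .base τb (h1.weaken h)
  | .array τ n h1 hn => .array τ n (h1.weaken h) hn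
  | .struct t ht => .struct t (h t ht)
  | .union t ht => .union t (h t ht)
end

theorem TypeValid.of_array {Γ : Env K} {τ : CType K} {n : ℕ} (h : TypeValid Γ (.array τ n)) :
    TypeValid Γ τ := by
  cases h; assumption

theorem TypeValid.of_base {Γ : Env K} {τb : BaseType K} (h : TypeValid Γ (.base τb)) :
    BaseTypeValid Γ τb := by
  cases h; assumption

/-- The step of `TypeValid.ind` for a type that is valid in a smaller environment `Γ₀`: if the
claim holds for the fields declared in `Γ₀`, then it holds for every valid type of `Γ₀`. -/
theorem TypeValid.ind_of_fields {Γ₀ Γ : Env K} {P : CType K → Prop}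
    (hbase : ∀ τb, BaseTypeValid Γ τb → P (.base τb))
    (harray : ∀ τ n, TypeValid Γ τ → n ≠ 0 → P τ → P (.array τ n))
    (hstruct : ∀ t τs, Γ.fields t = some τs → (∀ τ ∈ τs, TypeValid Γ τ) → (∀ τ ∈ τs, P τ) →
      P (.struct t))
    (hunion : ∀ t τs, Γ.fields t = some τs → (∀ τ ∈ τs, TypeValid Γ τ) → (∀ τ ∈ τs, P τ) →
      P (.union t))
    (hsub : ∀ t τs, Γ₀.fields t = some τs → Γ.fields t = some τs)
    (hfields : ∀ t τs, Γ₀.fields t = some τs → ∀ τ ∈ τs, TypeValid Γ τ ∧ P τ) :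
    ∀ τ : CType K, TypeValid Γ₀ τ → TypeValid Γ τ ∧ P τ
  | .base τb, h => by
    have h' : BaseTypeValid Γ τb := h.of_base.weaken fun t ht => by
      obtain ⟨τs, hτs⟩ := Finmap.mem_iff.1 ht
      exact Finmap.mem_of_lookup_eq_some (hsub t τs hτs)
    exact ⟨.base _ h', hbase _ h'⟩
  | .array τ n, h => by
    cases h with
    | array _ _ h hn =>
      obtain ⟨h1, h2⟩ := ind_of_fields hbase harray hstruct hunion hsub hfields τ h
      exact ⟨.array _ _ h1 hn, harray _ _ h1 hn h2⟩
  | .struct t, h => by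
    cases h with
    | struct _ ht =>
      obtain ⟨τs, hτs⟩ := Finmap.mem_iff.1 ht
      exact ⟨.struct _ (Finmap.mem_of_lookup_eq_some (hsub t τs hτs)),
        hstruct t τs (hsub t τs hτs) (fun τ h => (hfields t τs hτs τ h).1)
          fun τ h => (hfields t τs hτs τ h).2⟩
  | .union t, h => by
    cases h with
    | union _ ht =>
      obtain ⟨τs, hτs⟩ := Finmap.mem_iff.1 ht
      exact ⟨.union _ (Finmap.mem_of_lookup_eq_some (hsub t τs hτs)),
        hunion t τs (hsub t τs hτs) (fun τ h => (hfields t τs hτs τ h).1)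
          fun τ h => (hfields t τs hτs τ h).2⟩

/-- The claim is established for the declared fields by following the order of declarations; the
conclusion speaks of the final environment `Γ` throughout. -/
theorem TypeValid.ind_fields {Γ₀ Γ : Env K} {P : CType K → Prop} (hΓ₀ : EnvValid Γ₀)
    (hbase : ∀ τb, BaseTypeValid Γ τb → P (.base τb))
    (harray : ∀ τ n, TypeValid Γ τ → n ≠ 0 → P τ → P (.array τ n))
    (hstruct : ∀ t τs, Γ.fields t = some τs → (∀ τ ∈ τs, TypeValid Γ τ) → (∀ τ ∈ τs, P τ) →
      P (.struct t))
    (hunion : ∀ t τs, Γ.fields t = some τs → (∀ τ ∈ τs, TypeValid Γ τ) → (∀ τ ∈ τs, P τ) →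
      P (.union t))
    (hsub : ∀ t τs, Γ₀.fields t = some τs → Γ.fields t = some τs) :
    ∀ t τs, Γ₀.fields t = some τs → ∀ τ ∈ τs, TypeValid Γ τ ∧ P τ := by
  induction hΓ₀ with
  | empty => intro t τs h; simp [Env.fields] at h
  | compound Γ₁ t₀ τs₀ hΓ₁ hτs₀ _ ht₀ ih =>
    have hsub' : ∀ t τs, Γ₁.fields t = some τs → Γ.fields t = some τs := by
      intro t τs h
      have hne : t ≠ t₀ := by
        rintro rfl
        exact ht₀ (Finmap.mem_of_lookup_eq_some h)
      exact hsub t τs (by simpa [Env.fields, Finmap.lookup_insert_of_ne _ hne] using h)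
    intro t τs h
    by_cases hne : t = t₀
    · subst hne
      obtain rfl : τs₀ = τs := by simpa [Env.fields] using h
      exact fun τ hτ => TypeValid.ind_of_fields hbase harray hstruct hunion hsub' (ih hsub') τ
        (hτs₀ τ hτ)
    · exact ih hsub' t τs (by simpa [Env.fields, Finmap.lookup_insert_of_ne _ hne] using h)
  | func Γ₁ f τs τ _ _ _ _ ih => exact ih hsub

/-- Induction over the valid types of a well-formed environment, through the fields of structs
and unions. -/
theorem TypeValid.ind {Γ : Env K} (hΓ : EnvValid Γ) {P : (τ : CType K) → TypeValid Γ τ → Prop}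
    (base : ∀ τb (h : BaseTypeValid Γ τb), P (.base τb) (.base τb h))
    (array : ∀ τ n (hτ : TypeValid Γ τ) (hn : n ≠ 0), P τ hτ → P (.array τ n) (.array τ n hτ hn))
    (struct : ∀ t τs (ht : Γ.fields t = some τs) (hτs : ∀ τ ∈ τs, TypeValid Γ τ),
      (∀ τ (h : τ ∈ τs), P τ (hτs τ h)) →
      P (.struct t) (.struct t (Finmap.mem_of_lookup_eq_some ht)))
    (union : ∀ t τs (ht : Γ.fields t = some τs) (hτs : ∀ τ ∈ τs, TypeValid Γ τ),
      (∀ τ (h : τ ∈ τs), P τ (hτs τ h)) →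
      P (.union t) (.union t (Finmap.mem_of_lookup_eq_some ht)))
    {τ : CType K} (hτ : TypeValid Γ τ) : P τ hτ := by
  have h1 : ∀ τb, BaseTypeValid Γ τb → ∀ h, P (.base τb) h := fun τb h _ => base τb h
  have h2 : ∀ τ n, TypeValid Γ τ → n ≠ 0 → (∀ h, P τ h) → ∀ h, P (.array τ n) h :=
    fun τ n h hn hP _ => array τ n h hn (hP h)
  have h3 : ∀ t τs, Γ.fields t = some τs → (∀ τ ∈ τs, TypeValid Γ τ) →
      (∀ τ ∈ τs, ∀ h, P τ h) → ∀ h, P (.struct t) h :=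
    fun t τs ht hτs hP _ => struct t τs ht hτs fun τ h => hP τ h _
  have h4 : ∀ t τs, Γ.fields t = some τs → (∀ τ ∈ τs, TypeValid Γ τ) →
      (∀ τ ∈ τs, ∀ h, P τ h) → ∀ h, P (.union t) h :=
    fun t τs ht hτs hP _ => union t τs ht hτs fun τ h => hP τ h _
  exact (TypeValid.ind_of_fields (P := fun τ => ∀ h, P τ h) h1 h2 h3 h4 (fun _ _ h => h)
    (TypeValid.ind_fields hΓ h1 h2 h3 h4 fun _ _ h => h) τ hτ).2 hτ

theorem EnvValid.fields_valid {Γ : Env K} (hΓ : EnvValid Γ) {t : String} {τs : List (CType K)}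
    (ht : Γ.fields t = some τs) {τ : CType K} (hτ : τ ∈ τs) : TypeValid Γ τ :=
  (TypeValid.ind_fields (P := fun _ => True) hΓ (fun _ _ => trivial) (fun _ _ _ _ _ => trivial)
    (fun _ _ _ _ _ => trivial) (fun _ _ _ _ _ => trivial) (fun _ _ h => h) t τs ht τ hτ).1

theorem Env.field_eq_some {Γ : Env K} {t : String} {i : ℕ} {τ : CType K} :
    Γ.field t i = some τ ↔ ∃ τs, Γ.fields t = some τs ∧ τs[i]? = some τ := by
  simp [Env.field, Option.bind_eq_some_iff]

variable [LinearOrder K] (E : ImplEnv K) {Γ : Env K}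

theorem bitSize_array (τ : CType K) (n : ℕ) :
    bitSize E Γ (.array τ n) = n * bitSize E Γ τ := by
  simp [bitSize, E.sizeOf_array, mul_assoc]

theorem sum_fieldBitSizes (hΓ : EnvValid Γ) {t : String} {τs : List (CType K)}
    (ht : Γ.fields t = some τs) :
    (fieldBitSizes E Γ τs).sum = bitSize E Γ (.struct t) := by
  rw [fieldBitSizes, bitSize, E.sizeOf_struct Γ t τs hΓ ht, List.sum_map_mul_right]
  simp

theorem fieldBitSizes_ge (hΓ : EnvValid Γ) (τs : List (CType K)) :
    List.Forall₂ (fun τ z => bitSize E Γ τ ≤ z) τs (fieldBitSizes E Γ τs) := by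
  rw [fieldBitSizes, List.forall₂_map_right_iff]
  exact (E.sizeOf_fields Γ τs hΓ).imp fun _ _ h => Nat.mul_le_mul_right _ h

theorem bitSize_le_union (hΓ : EnvValid Γ) {t : String} {τs : List (CType K)}
    (ht : Γ.fields t = some τs) {τ : CType K} (hτ : τ ∈ τs) :
    bitSize E Γ τ ≤ bitSize E Γ (.union t) :=
  Nat.mul_le_mul_right _ (E.sizeOf_union Γ t τs hΓ ht τ hτ)

theorem bitSize_int (τi : IntType K) :
    bitSize E Γ (.base (.int τi)) = E.charBits * E.rankSize τi.rank := by
  rw [bitSize, E.sizeOf_int, mul_comm]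

theorem bitSize_uchar : bitSize E Γ (uchar E) = E.charBits := by
  rw [uchar, bitSize_int, ucharInt, E.rankSize_char, mul_one]

theorem bitSize_base_pos (τb : BaseType K) : 0 < bitSize E Γ (.base τb) := by
  have h : 0 < E.charBits := by have := E.charBits_ge; omega
  refine Nat.mul_pos (Nat.pos_of_ne_zero ?_) h
  cases τb with
  | int τi => rw [E.sizeOf_int]; exact (E.rankSize_pos _).ne'
  | ptr τp => exact E.sizeOf_ptr_ne Γ τp
  | void => exact E.sizeOf_void_ne Γ

end Types

/-! ### Lists -/

/-- A chunk has the prescribed length, and its elements come from the given list. -/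
theorem getElem?_splitLengths {α : Type*} {zs : List ℕ} {l p : List α} {i : ℕ}
    (hl : zs.sum ≤ l.length) (h : (zs.splitLengths l)[i]? = some p) :
    zs[i]? = some p.length ∧ ∀ x ∈ p, x ∈ l := by
  induction zs generalizing l i with
  | nil => simp at h
  | cons z zs ih =>
    rw [List.sum_cons] at hl
    rw [List.splitLengths_cons] at h
    cases i with
    | zero =>
      simp only [List.getElem?_cons_zero, Option.some.injEq] at h
      subst h
      refine ⟨?_, fun x hx => List.mem_of_mem_take hx⟩
      simp; omega
    | succ i =>
      rw [List.getElem?_cons_succ] at h ⊢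
      obtain ⟨h1, h2⟩ := ih (by rw [List.length_drop]; omega) h
      exact ⟨h1, fun x hx => List.mem_of_mem_drop (h2 x hx)⟩

theorem map_splitLengths {α β : Type*} (f : α → β) (zs : List ℕ) (l : List α) :
    zs.splitLengths (l.map f) = (zs.splitLengths l).map (List.map f) := by
  induction zs generalizing l with
  | nil => rfl
  | cons z zs ih => simp [← List.map_drop, ih]

/-- Splitting a list into chunks and replacing each chunk by a pointwise related list gives
a list that is pointwise related to the original one. -/
theorem forall₂_flatten_zipWith_splitLengths {α β γ : Type*} {R : β → γ → Prop}
    {P : α → ℕ → Prop} {g : α → List γ → List β} {as : List α} {zs : List ℕ}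
    (h : List.Forall₂ P as zs)
    (hg : ∀ a z, a ∈ as → P a z → ∀ p : List γ, p.length = z → List.Forall₂ R (g a p) p)
    {l : List γ} (hl : l.length = zs.sum) :
    List.Forall₂ R (List.zipWith g as (zs.splitLengths l)).flatten l := by
  induction h generalizing l with
  | nil => simpa using hl
  | @cons a z as zs h1 _ ih =>
    rw [List.sum_cons] at hl
    rw [List.splitLengths_cons, List.zipWith_cons_cons, List.flatten_cons]
    conv_rhs => rw [← List.take_append_drop z l]
    exact List.rel_append
      (hg a z List.mem_cons_self h1 _ (by rw [List.length_take]; omega))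
      (ih (fun a z ha => hg a z (List.mem_cons_of_mem _ ha)) (by rw [List.length_drop]; omega))

theorem forall₂_map_flatten_splitLengths_replicate {β γ : Type*} {R : β → γ → Prop}
    {g : List γ → List β} {n z : ℕ}
    (hg : ∀ p : List γ, p.length = z → List.Forall₂ R (g p) p)
    {l : List γ} (hl : l.length = n * z) :
    List.Forall₂ R (((List.replicate n z).splitLengths l).map g).flatten l := by
  induction n generalizing l with
  | zero => simpa using hl
  | succ n ih =>
    rw [Nat.succ_mul] at hl
    rw [List.replicate_succ, List.splitLengths_cons, List.map_cons, List.flatten_cons]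
    conv_rhs => rw [← List.take_append_drop z l]
    exact List.rel_append (hg _ (by rw [List.length_take]; omega))
      (ih (by rw [List.length_drop]; omega))

/-! ### References -/

section References

variable {K : Type*} {Γ : Env K}

theorem RefTyped.setOffset {r : Ref K} {τ σ : CType K} (h : RefTyped Γ r τ σ) {j : ℕ}
    (hj : j < r.size) : RefTyped Γ (r.setOffset j) τ σ := by
  induction h with
  | nil τ => exact .nil τ
  | cons s r τ σ ρ hs hr ih =>
    cases r with
    | nil =>
      cases hr
      cases hs with
      | array i n σ hi => exact .cons _ _ _ _ _ (.array j n σ hj) (.nil _)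
      | struct i t σ hi => exact .cons _ _ _ _ _ (.struct i t σ hi) (.nil _)
      | union i t q σ hi => exact .cons _ _ _ _ _ (.union i t q σ hi) (.nil _)
    | cons s' r =>
      have h1 : Ref.setOffset j (s :: s' :: r) = s :: Ref.setOffset j (s' :: r) := by
        simp only [Ref.setOffset, List.getLast?_cons_cons]
        split <;> simp
      rw [h1]
      refine .cons _ _ _ _ _ hs (ih ?_)
      simpa only [Ref.size, List.getLast?_cons_cons] using hj

theorem Ref.setOffset_offset (r : Ref K) : r.setOffset r.offset = r := by
  rcases List.eq_nil_or_concat' r with rfl | ⟨r, s, rfl⟩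
  · rfl
  · cases s <;> simp [Ref.setOffset, Ref.offset]

theorem RefTyped.typeValid (hΓ : EnvValid Γ) {r : Ref K} {τ σ : CType K}
    (h : RefTyped Γ r τ σ) (hτ : TypeValid Γ τ) : TypeValid Γ σ := by
  induction h with
  | nil => exact hτ
  | cons s r τ σ ρ hs _ ih =>
    refine ih ?_
    cases hs with
    | array i n σ hi => exact hτ.of_array
    | struct i t σ hi =>
      obtain ⟨τs, ht, hi⟩ := Env.field_eq_some.1 hi
      exact hΓ.fields_valid ht (List.mem_of_getElem? hi)
    | union i t q σ hi =>
      obtain ⟨τs, ht, hi⟩ := Env.field_eq_some.1 hi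
      exact hΓ.fields_valid ht (List.mem_of_getElem? hi)

theorem RefTyped.freeze {r : Ref K} {τ σ : CType K} (h : RefTyped Γ r τ σ) :
    RefTyped Γ r.freeze τ σ := by
  induction h with
  | nil τ => exact .nil τ
  | cons s r τ σ ρ hs hr ih =>
    refine .cons _ _ _ σ _ ?_ ih
    cases hs with
    | array i n σ hi => exact .array i n σ hi
    | struct i t σ hi => exact .struct i t σ hi
    | union i t q σ hi => exact .union i t .frozen σ hi

theorem Ref.offset_freeze (r : Ref K) : r.freeze.offset = r.offset := by
  rcases List.eq_nil_or_concat' r with rfl | ⟨r, s, rfl⟩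
  · rfl
  · cases s <;> simp [Ref.freeze, Ref.offset, RefSeg.freeze]

theorem Ref.size_freeze (r : Ref K) : r.freeze.size = r.size := by
  rcases List.eq_nil_or_concat' r with rfl | ⟨r, s, rfl⟩
  · rfl
  · cases s <;> simp [Ref.freeze, Ref.size, RefSeg.freeze]

theorem Ref.freeze_freeze (r : Ref K) : r.freeze.freeze = r.freeze := by
  simp only [Ref.freeze, List.map_map]
  refine List.map_congr_left fun s _ => ?_
  cases s <;> rfl

theorem Ptr.frozen_freeze (p : Ptr K) : p.freeze.Frozen := by
  cases p with
  | addr a => simp [Ptr.Frozen, Ptr.freeze, Addr.freeze, Ref.freeze_freeze]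
  | _ => rfl

theorem Ref.freeze_refine (r : Ref K) : List.Forall₂ RefSegRefine r.freeze r := by
  rw [Ref.freeze, List.forall₂_map_left_iff]
  refine List.forall₂_same.2 fun s _ => ?_
  cases s with
  | union i t q =>
    cases q
    · exact .refl _
    · exact .thaw i t
  | _ => exact .refl _

end References

/-! ### The information order on bits -/

section Trees

variable {K : Type*}

/-- The information order on bits: the indeterminate bit is the least element, and distinct
other bits are incomparable. -/
def Bit.Le (c b : Bit K) : Prop := c = .indet ∨ c = b

/-- The information order on bits, for bits with the same permission. -/
def PBit.Le (c b : PBit K) : Prop := c.1 = b.1 ∧ Bit.Le c.2 b.2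

theorem Bit.Le.refl (b : Bit K) : Bit.Le b b := .inr rfl

theorem Bit.Le.forall₂_refl (bs : List (Bit K)) : List.Forall₂ Bit.Le bs bs :=
  List.forall₂_same.2 fun b _ => .refl b

theorem Bit.Le.eq_of_ne_indet {bs cs : List (Bit K)} (h : List.Forall₂ Bit.Le cs bs)
    (hcs : ∀ c ∈ cs, c ≠ .indet) : cs = bs := by
  induction h with
  | nil => rfl
  | cons h _ ih =>
    rw [List.forall_mem_cons] at hcs
    rw [h.resolve_left hcs.1, ih hcs.2]

theorem Bit.Le.forall_indet {bs cs : List (Bit K)} (h : List.Forall₂ Bit.Le cs bs)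
    (hbs : ∀ b ∈ bs, b = .indet) : ∀ c ∈ cs, c = .indet := by
  induction h with
  | nil => simp
  | cons h _ ih =>
    rw [List.forall_mem_cons] at hbs ⊢
    exact ⟨h.elim id fun h => h.trans hbs.1, ih hbs.2⟩

theorem Bit.Le.replicate_indet {bs : List (Bit K)} {n : ℕ} (h : bs.length = n) :
    List.Forall₂ Bit.Le (List.replicate n .indet) bs := by
  subst h
  induction bs with
  | nil => exact .nil
  | cons b bs ih => exact .cons (.inl rfl) ih

theorem Bit.Le.join {b c d : Bit K} (h1 : Bit.Le b d) (h2 : Bit.Le c d) :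
    Bit.Le (b.join c) d := by
  unfold Bit.join
  split_ifs <;> first | assumption | exact .inl rfl

theorem Bit.Le.takeD {k : ℕ} {cs bs : List (Bit K)} (h : List.Forall₂ Bit.Le cs (bs.take k)) :
    List.Forall₂ Bit.Le (List.takeD bs.length cs .indet) bs := by
  induction bs generalizing cs k with
  | nil => exact .nil
  | cons b bs ih =>
    cases k with
    | zero =>
      cases h
      exact .cons (.inl rfl) (ih (k := 0) .nil)
    | succ k =>
      cases h with
      | cons h1 h2 => exact .cons h1 (ih h2)

/-- The join, as formed in `Val.flatten` for unions of unspecified variant, of lists of bits that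
lie below `bs` again lies below `bs`. -/
theorem Bit.Le.foldr_join {n : ℕ} {css : List (List (Bit K))} {bs : List (Bit K)}
    (hl : bs.length = n)
    (h : ∀ cs ∈ css, List.Forall₂ Bit.Le (List.takeD n cs .indet) bs) :
    List.Forall₂ Bit.Le (css.foldr
      (fun cs ds => List.zipWith Bit.join (List.takeD n cs .indet) ds)
      (List.replicate n .indet)) bs := by
  induction css with
  | nil => exact Bit.Le.replicate_indet hl
  | cons cs css ih =>
    rw [List.forall_mem_cons] at h
    have h1 := h.1
    have h2 := ih h.2
    rw [List.foldr_cons]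
    generalize List.takeD n cs .indet = cs at h1
    generalize List.foldr _ _ _ = ds at h2
    clear hl h ih
    induction h1 generalizing ds with
    | nil => cases h2; exact .nil
    | cons h _ ih =>
      cases h2 with
      | cons h' h2 => exact .cons (h.join h') (ih _ h2)

theorem PBit.Le.refl (b : PBit K) : PBit.Le b b := ⟨rfl, .refl _⟩

theorem PBit.indetify_le (b : PBit K) : PBit.Le b.indetify b := ⟨rfl, .inl rfl⟩

theorem PBit.Le.map_fst {cs bs : List (PBit K)} (h : List.Forall₂ PBit.Le cs bs) :
    cs.map Prod.fst = bs.map Prod.fst := by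
  induction h with
  | nil => rfl
  | cons h _ ih => rw [List.map_cons, List.map_cons, ih, h.1]

theorem PBit.Le.map_snd {cs bs : List (PBit K)} (h : List.Forall₂ PBit.Le cs bs) :
    List.Forall₂ Bit.Le (cs.map Prod.snd) (bs.map Prod.snd) := by
  induction h with
  | nil => exact .nil
  | cons h _ ih => exact .cons h.2 ih

theorem Bit.IsConcrete.ne_indet {b : Bit K} (h : b.IsConcrete) : b ≠ .indet := by
  obtain ⟨β, rfl⟩ := h
  nofun

theorem Bit.map_bit_toBool {bs : List (Bit K)} (h : ∀ b ∈ bs, b.IsConcrete) :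
    (bs.map Bit.toBool).map Bit.bit = bs := by
  rw [List.map_map]
  refine (List.map_congr_left fun b hb => ?_).trans (List.map_id bs)
  obtain ⟨β, rfl⟩ := h b hb
  rfl

/-! ### Typing of memory trees -/

variable [LinearOrder K] (E : ImplEnv K) (Γ : Env K)

theorem mtreeUnflatten_base (τb : BaseType K) (bs : List (PBit K)) :
    mtreeUnflatten E Γ (.base τb) bs = .base τb bs := by
  simp [mtreeUnflatten, typeRec, typeRecAux]

theorem mtreeUnflatten_array (τ : CType K) (n : ℕ) (bs : List (PBit K)) :
    mtreeUnflatten E Γ (.array τ n) bs =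
      .array τ (((List.replicate n (bitSize E Γ τ)).splitLengths bs).map
        (mtreeUnflatten E Γ τ)) := by
  rw [mtreeUnflatten, typeRec_array]

variable {Γ}

theorem mtreeUnflatten_struct (hΓ : EnvValid Γ) {t : String} {τs : List (CType K)}
    (ht : Γ.fields t = some τs) (bs : List (PBit K)) :
    mtreeUnflatten E Γ (.struct t) bs = .struct t (List.zipWith
      (fun τ p => (mtreeUnflatten E Γ τ (p.take (bitSize E Γ τ)),
        (p.drop (bitSize E Γ τ)).map PBit.indetify))
      τs ((fieldBitSizes E Γ τs).splitLengths bs)) := by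
  rw [mtreeUnflatten, typeRec_struct _ _ _ _ hΓ t τs ht]
  simp [List.zipWith_map_left, Function.comp_def]

theorem mtreeUnflatten_union (hΓ : EnvValid Γ) {t : String} {τs : List (CType K)}
    (ht : Γ.fields t = some τs) (bs : List (PBit K)) :
    mtreeUnflatten E Γ (.union t) bs = .unionAll t bs := by
  rw [mtreeUnflatten, typeRec_union _ _ _ _ hΓ t τs ht]

/-- Flattening an unflattened tree only makes padding bits indeterminate. -/
theorem flatten_mtreeUnflatten_le (hΓ : EnvValid Γ) {τ : CType K} (hτ : TypeValid Γ τ)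
    {bs : List (PBit K)} (hl : bs.length = bitSize E Γ τ) :
    List.Forall₂ PBit.Le (mtreeUnflatten E Γ τ bs).flatten bs := by
  induction hτ using TypeValid.ind hΓ generalizing bs with
  | base τb =>
    rw [mtreeUnflatten_base, MTree.flatten]
    exact List.forall₂_same.2 fun b _ => .refl b
  | array τ n hτ hn ih =>
    rw [mtreeUnflatten_array, MTree.flatten, List.flatMap_map, List.flatMap_def]
    exact forall₂_map_flatten_splitLengths_replicate (fun p hp => ih hp)
      (hl.trans (bitSize_array E τ n))
  | struct t τs ht hτs ih =>
    rw [mtreeUnflatten_struct E hΓ ht, MTree.flatten, List.flatMap_def, List.map_zipWith]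
    refine forall₂_flatten_zipWith_splitLengths (fieldBitSizes_ge E hΓ τs) ?_
      (hl.trans (sum_fieldBitSizes E hΓ ht).symm)
    intro τ z hτ hz p hp
    conv_rhs => rw [← List.take_append_drop (bitSize E Γ τ) p]
    refine List.rel_append (ih τ hτ (by rw [List.length_take]; omega)) ?_
    rw [List.forall₂_map_left_iff]
    exact List.forall₂_same.2 fun b _ => b.indetify_le
  | union t τs ht hτs ih =>
    rw [mtreeUnflatten_union E hΓ ht, MTree.flatten]
    exact List.forall₂_same.2 fun b _ => .refl b

variable {E} {Δ : MemEnv K}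

theorem PBitValid.indetify {b : PBit K} (h : PBitValid E Γ Δ b) :
    PBitValid E Γ Δ b.indetify ∧ b.indetify.2 = .indet :=
  ⟨⟨.indet, h.2.1, fun _ => rfl⟩, rfl⟩

theorem PBitValid.map_indetify {bs : List (PBit K)} (h : ∀ b ∈ bs, PBitValid E Γ Δ b) :
    ∀ b ∈ bs.map PBit.indetify, PBitValid E Γ Δ b ∧ b.2 = .indet := by
  intro b hb
  obtain ⟨c, hc, rfl⟩ := List.mem_map.1 hb
  exact (h c hc).indetify

theorem mtreeTyped_mtreeUnflatten (hΓ : EnvValid Γ) {τ : CType K} (hτ : TypeValid Γ τ)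
    {bs : List (PBit K)} (hbs : ∀ b ∈ bs, PBitValid E Γ Δ b) (hl : bs.length = bitSize E Γ τ) :
    MTreeTyped E Γ Δ (mtreeUnflatten E Γ τ bs) τ := by
  induction hτ using TypeValid.ind hΓ generalizing bs with
  | base τb hτb =>
    rw [mtreeUnflatten_base]
    exact .base τb bs hτb hbs hl
  | array τ n hτ hn ih =>
    rw [mtreeUnflatten_array]
    have h := MTreeTyped.array (E := E) (Γ := Γ) (Δ := Δ) τ
      (((List.replicate n (bitSize E Γ τ)).splitLengths bs).map (mtreeUnflatten E Γ τ))
    simp only [List.length_map, List.length_splitLengths, List.length_replicate] at h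
    refine h (fun w hw => ?_) hn
    obtain ⟨p, hp, rfl⟩ := List.mem_map.1 hw
    obtain ⟨i, hi⟩ := List.mem_iff_getElem?.1 hp
    obtain ⟨h1, h2⟩ := getElem?_splitLengths
      (by rw [List.sum_replicate, smul_eq_mul, hl, bitSize_array]) hi
    refine ih (fun b hb => hbs b (h2 b hb)) ?_
    rw [List.getElem?_replicate] at h1
    split at h1 <;> simp_all
  | struct t τs ht hτs ih =>
    have hz := fieldBitSizes_ge E hΓ τs
    have key : ∀ (i : ℕ) (w : MTree K) (cs : List (PBit K)) (τ : CType K),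
        (List.zipWith (fun τ p => (mtreeUnflatten E Γ τ (p.take (bitSize E Γ τ)),
          (p.drop (bitSize E Γ τ)).map PBit.indetify))
        τs ((fieldBitSizes E Γ τs).splitLengths bs))[i]? = some (w, cs) → τs[i]? = some τ →
        ∃ p : List (PBit K), (fieldBitSizes E Γ τs)[i]? = some p.length ∧
          bitSize E Γ τ ≤ p.length ∧ (∀ b ∈ p, b ∈ bs) ∧
          mtreeUnflatten E Γ τ (p.take (bitSize E Γ τ)) = w ∧
          (p.drop (bitSize E Γ τ)).map PBit.indetify = cs := by
      intro i w cs τ h hi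
      obtain ⟨τ', p, h1, h2, h3⟩ := List.getElem?_zipWith_eq_some.1 h
      obtain rfl : τ = τ' := Option.some_inj.1 (hi.symm.trans h1)
      obtain ⟨h4, h5⟩ := getElem?_splitLengths
        (by rw [hl, sum_fieldBitSizes E hΓ ht]) h2
      refine ⟨p, h4, ?_, h5, congrArg Prod.fst h3, congrArg Prod.snd h3⟩
      obtain ⟨hi1, rfl⟩ := List.getElem?_eq_some_iff.1 hi
      obtain ⟨hi2, h6⟩ := List.getElem?_eq_some_iff.1 h4
      rw [← h6]
      exact (List.forall₂_iff_get.1 hz).2 i hi1 hi2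
    rw [mtreeUnflatten_struct E hΓ ht]
    refine .struct t _ τs ht ?_ ?_ ?_
    · simp [fieldBitSizes, ← (E.sizeOf_fields Γ τs hΓ).length_eq]
    · intro i w cs τ h hi
      obtain ⟨p, _, h1, h2, rfl, _⟩ := key i w cs τ h hi
      exact ih τ (List.mem_of_getElem? hi) (fun b hb => hbs b (h2 b (List.mem_of_mem_take hb)))
        (by rw [List.length_take]; omega)
    · intro i w cs τ z h hi hz
      obtain ⟨p, h0, h1, h2, _, rfl⟩ := key i w cs τ h hi
      obtain rfl : z = p.length := Option.some_inj.1 (hz.symm.trans h0)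
      exact ⟨PBitValid.map_indetify fun b hb => hbs b (h2 b (List.mem_of_mem_drop hb)), by simp⟩
  | union t τs ht hτs ih =>
    rw [mtreeUnflatten_union E hΓ ht]
    exact .unionAll t bs (Finmap.mem_of_lookup_eq_some ht) hbs hl

theorem MTreeTyped.typeOf_eq {w : MTree K} {τ : CType K} (h : MTreeTyped E Γ Δ w τ) :
    w.typeOf = τ := by
  cases h <;> rfl

theorem MTreeTyped.length_flatten (hΓ : EnvValid Γ) {w : MTree K} {τ : CType K}
    (h : MTreeTyped E Γ Δ w τ) : w.flatten.length = bitSize E Γ τ := by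
  induction h with
  | base τb bs _ _ hl => rwa [MTree.flatten]
  | array τ ws _ _ ih =>
    rw [MTree.flatten, List.length_flatMap, bitSize_array, List.map_congr_left ih,
      List.map_const', List.sum_replicate, smul_eq_mul]
  | struct t fs τs ht hlen _ hpad ih =>
    have hz := fieldBitSizes_ge E hΓ τs
    rw [MTree.flatten, List.length_flatMap, ← sum_fieldBitSizes E hΓ ht]
    congr 1
    refine List.ext_getElem (by rw [List.length_map, hlen, hz.length_eq]) fun i h1 h2 => ?_
    rw [List.length_map] at h1
    have hi : i < τs.length := hlen ▸ h1
    have h3 := (List.forall₂_iff_get.1 hz).2 i hi h2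
    have h4 := ih i fs[i].1 fs[i].2 τs[i] (List.getElem?_eq_getElem h1)
      (List.getElem?_eq_getElem hi)
    have h5 := (hpad i fs[i].1 fs[i].2 τs[i] _ (List.getElem?_eq_getElem h1)
      (List.getElem?_eq_getElem hi) (List.getElem?_eq_getElem h2)).2
    simp only [List.get_eq_getElem] at h3
    rw [List.getElem_map, List.length_append]
    omega
  | union t i w bs τ _ _ _ hl _ ih => rw [MTree.flatten, List.length_append, ih, hl]
  | unionAll t bs _ _ hl => rwa [MTree.flatten]

theorem MTreeTyped.bits_valid (hΓ : EnvValid Γ) {w : MTree K} {τ : CType K}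
    (h : MTreeTyped E Γ Δ w τ) : ∀ b ∈ w.flatten, PBitValid E Γ Δ b := by
  induction h with
  | base τb bs _ hbs _ => rwa [MTree.flatten]
  | array τ ws _ _ ih =>
    rw [MTree.flatten]
    intro b hb
    obtain ⟨w, hw, hb⟩ := List.mem_flatMap.1 hb
    exact ih w hw b hb
  | struct t fs τs ht hlen _ hpad ih =>
    rw [MTree.flatten]
    intro b hb
    obtain ⟨f, hf, hb⟩ := List.mem_flatMap.1 hb
    obtain ⟨i, h1, rfl⟩ := List.getElem_of_mem hf
    have hi : i < τs.length := hlen ▸ h1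
    have h2 : i < (fieldBitSizes E Γ τs).length :=
      (fieldBitSizes_ge E hΓ τs).length_eq ▸ hi
    rcases List.mem_append.1 hb with hb | hb
    · exact ih i fs[i].1 fs[i].2 τs[i] (List.getElem?_eq_getElem h1)
        (List.getElem?_eq_getElem hi) b hb
    · exact ((hpad i fs[i].1 fs[i].2 τs[i] _ (List.getElem?_eq_getElem h1)
        (List.getElem?_eq_getElem hi) (List.getElem?_eq_getElem h2)).1 b hb).1
  | union t i w bs τ _ _ hbs _ _ ih =>
    rw [MTree.flatten]
    intro b hb
    rcases List.mem_append.1 hb with hb | hb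
    · exact ih b hb
    · exact (hbs b hb).1
  | unionAll t bs _ hbs _ => rwa [MTree.flatten]

/-! ### Lookup and alteration of memory trees -/

/-- A union variant that is not the current one is read off the bits of the whole union. -/
theorem MTreeTyped.variant (hΓ : EnvValid Γ) {t : String} {i : ℕ} {σ : CType K} {w : MTree K}
    (h : MTreeTyped E Γ Δ w (.union t)) (hi : Γ.field t i = some σ) :
    MTreeTyped E Γ Δ (mtreeUnflatten E Γ σ (w.flatten.take (bitSize E Γ σ))) σ := by
  obtain ⟨τs, ht, hi⟩ := Env.field_eq_some.1 hi
  have hσ := List.mem_of_getElem? hi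
  have hle := bitSize_le_union E hΓ ht hσ
  refine mtreeTyped_mtreeUnflatten hΓ (hΓ.fields_valid ht hσ)
    (fun b hb => h.bits_valid hΓ b (List.mem_of_mem_take hb)) ?_
  rw [List.length_take, h.length_flatten hΓ]
  omega

theorem MTreeTyped.mtreeLookup (hΓ : EnvValid Γ) {r : Ref K} {τ σ : CType K}
    (hr : RefTyped Γ r τ σ) {w w' : MTree K} (hw : MTreeTyped E Γ Δ w τ)
    (h : mtreeLookup E Γ r w = some w') : MTreeTyped E Γ Δ w' σ := by
  induction hr generalizing w with
  | nil τ =>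
    simp only [CH2O.mtreeLookup, Option.some.injEq] at h
    exact h ▸ hw
  | cons s r τ σ ρ hs _ ih =>
    cases hs with
    | array i n σ hi =>
      cases hw with
      | array _ ws hws _ =>
        simp only [CH2O.mtreeLookup, if_true, Option.bind_eq_some_iff] at h
        obtain ⟨w₁, hw₁, h⟩ := h
        exact ih (hws w₁ (List.mem_of_getElem? hw₁)) h
    | struct i t σ hi =>
      cases hw with
      | struct _ fs τs ht hlen hfs _ =>
        simp only [CH2O.mtreeLookup, if_true, Option.bind_eq_some_iff] at h
        obtain ⟨f, hf, h⟩ := h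
        obtain ⟨τs', ht', hi⟩ := Env.field_eq_some.1 hi
        obtain rfl : τs = τs' := Option.some_inj.1 (ht.symm.trans ht')
        exact ih (hfs i f.1 f.2 σ hf hi) h
    | union i t q σ hi =>
      have hvar := hw.variant hΓ hi
      cases hw with
      | union _ j w₁ bs τ hj hw₁ hbs hl hm =>
        simp only [CH2O.mtreeLookup, if_true] at h
        split at h
        · subst_vars
          obtain rfl : τ = σ := Option.some_inj.1 (hj.symm.trans hi)
          exact ih hw₁ h
        · split at h
          · rw [hi, Option.bind_some] at h
            rw [MTree.flatten] at hvar
            exact ih hvar h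
          · simp at h
      | unionAll _ bs _ hbs hl =>
        simp only [CH2O.mtreeLookup, true_and] at h
        split at h
        · rw [hi, Option.bind_some] at h
          rw [MTree.flatten] at hvar
          exact ih hvar h
        · simp at h

/-- After an alteration the unions on the path have the variants selected by the path, so the
lookup succeeds without type-punning. -/
theorem mtreeLookup_mtreeAlter (f : MTree K → MTree K) {r : Ref K} {w w' : MTree K}
    (h : mtreeLookup E Γ r w = some w') :
    mtreeLookup E Γ r (mtreeAlter E Γ f r w) = some (f w') := by
  induction r generalizing w with
  | nil =>
    simp only [mtreeLookup, Option.some.injEq] at h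
    simp [mtreeAlter, mtreeLookup, h]
  | cons s r ih =>
    cases s with
    | array i τ n =>
      cases w with
      | array τ' ws =>
        simp only [mtreeLookup] at h
        split at h
        · obtain ⟨w₁, hw₁, h⟩ := Option.bind_eq_some_iff.1 h
          simp [mtreeAlter, mtreeLookup, *, ih h]
        · simp at h
      | _ => simp [mtreeLookup] at h
    | struct i t =>
      cases w with
      | struct t' fs =>
        simp only [mtreeLookup] at h
        split at h
        · obtain ⟨w₁, hw₁, h⟩ := Option.bind_eq_some_iff.1 h
          simp [mtreeAlter, mtreeLookup, *, ih h]
        · simp at h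
      | _ => simp [mtreeLookup] at h
    | union i t q =>
      cases w with
      | union t' j w₁ bs =>
        simp only [mtreeLookup] at h
        split at h
        · subst_vars
          split at h
          · simp [mtreeAlter, mtreeLookup, *, ih h]
          · split at h
            · obtain ⟨τ, hτ, h⟩ := Option.bind_eq_some_iff.1 h
              simp [mtreeAlter, mtreeLookup, *, ih h]
            · simp at h
        · simp at h
      | unionAll t' bs =>
        simp only [mtreeLookup] at h
        split at h
        · rename_i hc
          obtain ⟨rfl, _⟩ := hc
          obtain ⟨τ, hτ, h⟩ := Option.bind_eq_some_iff.1 h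
          simp [mtreeAlter, mtreeLookup, *, ih h]
        · simp at h
      | _ => simp [mtreeLookup] at h

end Trees

/-! ### Pointers and base values -/

section BaseValues

variable {K : Type*} [LinearOrder K] {E : ImplEnv K} {Γ : Env K} {Δ : MemEnv K}

theorem PtrTyped.typeOf_eq {p : Ptr K} {σp : PtrType K} (h : PtrTyped E Γ Δ p σp) :
    p.typeOf = σp := by
  cases h with
  | addr a _ h => cases h; rfl
  | _ => rfl

theorem AddrTyped.freeze {a : Addr K} {σp : PtrType K} (h : AddrTyped E Γ Δ a σp) :
    AddrTyped E Γ Δ a.freeze σp := by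
  cases h with
  | mk o τ r i σ σp h1 h2 h3 h4 h5 h6 h7 =>
    exact .mk o τ r.freeze i σ σp h1 h2 h3.freeze (r.offset_freeze.trans h4)
      (by rwa [r.size_freeze]) h6 h7

theorem PtrTyped.freeze {p : Ptr K} {σp : PtrType K} (h : PtrTyped E Γ Δ p σp) :
    PtrTyped E Γ Δ p.freeze σp := by
  cases h with
  | null _ h => exact .null _ h
  | addr a _ h => exact .addr _ _ h.freeze
  | func f τs τ h => exact .func f τs τ h

/-- A pointer is refined by thawing its frozen version. -/
theorem PtrTyped.freeze_refine {p : Ptr K} {σp : PtrType K} (h : PtrTyped E Γ Δ p σp) :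
    PtrRefine E Γ memInjId Δ Δ p.freeze p σp := by
  cases h with
  | null _ h => exact .null _ h
  | func f τs τ h => exact .func f τs τ h
  | addr a _ h =>
    refine .addr _ _ _ ?_
    have hf := h.freeze
    cases h with
    | mk o τ r i σ σp h1 h2 h3 h4 h5 h6 h7 =>
      -- The reference has offset zero, so rebasing the address at its object changes nothing.
      have h8 : r.freeze.setOffset 0 = r.freeze := by
        rw [← h4, ← r.offset_freeze, Ref.setOffset_offset]
      have h9 := AddrRefine.mk (f := memInjId) o o τ τ [] r.freeze r i σ σp rfl hf h1 h2 (.nil τ)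
        (by rw [List.nil_append, h8]; exact r.freeze_refine)
      rwa [List.nil_append, r.offset_freeze, h4, mul_zero, add_zero] at h9

theorem PtrTyped.refine_self {p : Ptr K} {σp : PtrType K} (h : PtrTyped E Γ Δ p σp)
    (hp : p.Frozen) : PtrRefine E Γ memInjId Δ Δ p p σp := by
  have h1 := h.freeze_refine
  rwa [hp] at h1

theorem Bit.Le.refine {b c : Bit K} (h : Bit.Le c b) (hb : BitValid E Γ Δ b) :
    BitRefine E Γ memInjId Δ Δ c b := by
  rcases h with rfl | rfl
  · exact .indet b hb
  · cases hb with
    | indet => exact .indet _ .indet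
    | bit β => exact .bit β
    | ptr p σp i h1 h2 h3 => exact .ptr p p σp i (h1.refine_self h2) h2 h3

theorem Bit.Le.valid {b c : Bit K} (h : Bit.Le c b) (hb : BitValid E Γ Δ b) :
    BitValid E Γ Δ c := by
  rcases h with rfl | rfl
  · exact .indet
  · exact hb

theorem Bit.Le.forall_valid {bs cs : List (Bit K)} (h : List.Forall₂ Bit.Le cs bs)
    (hbs : ∀ b ∈ bs, BitValid E Γ Δ b) : ∀ c ∈ cs, BitValid E Γ Δ c := by
  induction h with
  | nil => simp
  | cons h _ ih =>
    rw [List.forall_mem_cons] at hbs ⊢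
    exact ⟨h.valid hbs.1, ih hbs.2⟩

theorem Bit.Le.forall₂_refine {bs cs : List (Bit K)} (h : List.Forall₂ Bit.Le cs bs)
    (hbs : ∀ b ∈ bs, BitValid E Γ Δ b) : List.Forall₂ (BitRefine E Γ memInjId Δ Δ) cs bs := by
  induction h with
  | nil => exact .nil
  | cons h _ ih =>
    rw [List.forall_mem_cons] at hbs
    exact .cons (h.refine hbs.1) (ih hbs.2)

variable (E Γ) in
theorem length_ptrBits (σp : PtrType K) (p : Ptr K) :
    (ptrBits E Γ σp p).length = bitSize E Γ (.base (.ptr σp)) := by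
  simp [ptrBits]

theorem ptrBits_ne_indet {σp : PtrType K} {p : Ptr K} :
    ∀ b ∈ ptrBits E Γ σp p, b ≠ .indet := by
  simp [ptrBits]

variable (E Γ) in
theorem first_mem_ptrBits (σp : PtrType K) (p : Ptr K) :
    Bit.ptr p 0 ∈ ptrBits E Γ σp p := by
  simp [ptrBits, bitSize_base_pos]

theorem ptrBits_injective {σp : PtrType K} {p q : Ptr K}
    (h : ptrBits E Γ σp p = ptrBits E Γ σp q) : p = q := by
  have h1 := first_mem_ptrBits E Γ σp p
  rw [h, ptrBits, List.mem_map] at h1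
  obtain ⟨i, _, h1⟩ := h1
  cases h1
  rfl

/-- The first fragment of a pointer carries the whole pointer, so its validity shows that the
pointer is well-typed and frozen. -/
theorem ptrBits_valid {σp : PtrType K} {p : Ptr K}
    (h : ∀ b ∈ ptrBits E Γ σp p, BitValid E Γ Δ b) (hp : p.typeOf = σp) :
    PtrTyped E Γ Δ p σp ∧ p.Frozen := by
  cases h _ (first_mem_ptrBits E Γ σp p) with
  | ptr _ σp' _ h1 h2 _ =>
    obtain rfl : σp' = σp := h1.typeOf_eq.symm.trans hp
    exact ⟨h1, h2⟩

theorem BaseValTyped.typeOf_eq {vb : BaseVal K} {τb : BaseType K}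
    (h : BaseValTyped E Γ Δ vb τb) : vb.typeOf E = τb := by
  cases h with
  | ptr p σp h => simp only [BaseVal.typeOf, h.typeOf_eq]
  | _ => rfl

theorem BaseValTyped.length_flatten {vb : BaseVal K} {τb : BaseType K}
    (h : BaseValTyped E Γ Δ vb τb) : (vb.flatten E Γ).length = bitSize E Γ (.base τb) := by
  cases h with
  | int x τi h => simp [BaseVal.flatten, length_intToBits, bitSize_int]
  | ptr p σp h => simp [BaseVal.flatten, length_ptrBits, h.typeOf_eq]
  | byte bs _ hl => exact hl.trans (bitSize_uchar E).symm
  | _ => simp [BaseVal.flatten]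

theorem BaseValTyped.flatten_valid {vb : BaseVal K} {τb : BaseType K}
    (h : BaseValTyped E Γ Δ vb τb) : ∀ b ∈ vb.flatten E Γ, BitValid E Γ Δ b := by
  cases h with
  | int x τi h =>
    intro b hb
    obtain ⟨β, _, rfl⟩ := List.mem_map.1 hb
    exact .bit β
  | ptr p σp h =>
    intro b hb
    obtain ⟨i, hi, rfl⟩ := List.mem_map.1 hb
    rw [h.typeOf_eq, List.mem_range] at hi
    exact .ptr _ σp i h.freeze p.frozen_freeze hi
  | byte bs hbs => exact hbs
  | _ =>
    intro b hb
    rw [List.eq_of_mem_replicate hb]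
    exact .indet

theorem baseValTyped_baseValUnflatten {τb : BaseType K} (hτb : BaseTypeValid Γ τb)
    {bs : List (Bit K)} (hbs : ∀ b ∈ bs, BitValid E Γ Δ b)
    (hl : bs.length = bitSize E Γ (.base τb)) :
    BaseValTyped E Γ Δ (baseValUnflatten E Γ τb bs) τb := by
  cases τb with
  | void => exact .void
  | int τi =>
    rw [baseValUnflatten]
    split_ifs with h1 h2
    · exact .int _ τi (intTyped_intOfBits _ (by rw [List.length_map, hl, bitSize_int]))
    · obtain ⟨rfl, h2⟩ := h2
      exact .byte bs hbs (hl.trans (bitSize_uchar E)) h1 h2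
    · exact .indet _ hτb nofun
  | ptr σp =>
    rw [baseValUnflatten]
    split_ifs with h
    · generalize h.choose = p, h.choose_spec = hp
      obtain ⟨rfl, hp⟩ := hp
      exact .ptr _ _ (ptrBits_valid hbs hp).1
    · exact .indet _ hτb nofun

/-- A sequence of bits is either represented faithfully by the base value that it denotes, or it
has no more information than the indeterminate value. -/
theorem flatten_baseValUnflatten {τb : BaseType K}
    {bs : List (Bit K)} (hbs : ∀ b ∈ bs, BitValid E Γ Δ b)
    (hl : bs.length = bitSize E Γ (.base τb)) :
    (baseValUnflatten E Γ τb bs).flatten E Γ = bs ∨ τb = .void ∨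
      τb ≠ .void ∧ ∀ cs, List.Forall₂ Bit.Le cs bs →
        baseValUnflatten E Γ τb cs = .indet τb := by
  cases τb with
  | void => exact .inr (.inl rfl)
  | int τi =>
    rw [baseValUnflatten]
    split_ifs with h1 h2
    · left
      rw [BaseVal.flatten, intToBits_intOfBits _ (by rw [List.length_map, hl, bitSize_int]),
        Bit.map_bit_toBool h1]
    · exact .inl rfl
    · refine .inr (.inr ⟨nofun, fun cs hcs => ?_⟩)
      rw [baseValUnflatten, if_neg, if_neg]
      · exact fun h3 => h2 ⟨h3.1, fun h4 => h3.2 (Bit.Le.forall_indet hcs h4)⟩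
      · intro h3
        rw [Bit.Le.eq_of_ne_indet hcs fun c hc => (h3 c hc).ne_indet] at h3
        exact h1 h3
  | ptr σp =>
    rw [baseValUnflatten]
    split_ifs with h
    · left
      generalize h.choose = p, h.choose_spec = hp
      obtain ⟨rfl, hp⟩ := hp
      rw [BaseVal.flatten, hp, (ptrBits_valid hbs hp).2]
    · refine .inr (.inr ⟨nofun, fun cs hcs => ?_⟩)
      rw [baseValUnflatten, dif_neg]
      rintro ⟨p, rfl, hp⟩
      exact h ⟨p, (Bit.Le.eq_of_ne_indet hcs ptrBits_ne_indet).symm, hp⟩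

theorem flatten_baseValUnflatten_le {τb : BaseType K}
    {bs : List (Bit K)} (hbs : ∀ b ∈ bs, BitValid E Γ Δ b)
    (hl : bs.length = bitSize E Γ (.base τb)) :
    List.Forall₂ Bit.Le ((baseValUnflatten E Γ τb bs).flatten E Γ) bs := by
  rcases flatten_baseValUnflatten hbs hl with h | rfl | ⟨_, h⟩
  · rw [h]
    exact Bit.Le.forall₂_refl bs
  · exact Bit.Le.replicate_indet hl
  · rw [h bs (Bit.Le.forall₂_refl bs)]
    exact Bit.Le.replicate_indet hl

/-- Bits that are not all concrete denote a byte or an indeterminate value. -/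
theorem BaseValTyped.refine_of_not_concrete {vb : BaseVal K} {τi : IntType K}
    (h : BaseValTyped E Γ Δ vb (.int τi)) {cs : List (Bit K)}
    (hcs : List.Forall₂ Bit.Le cs (vb.flatten E Γ)) (hc : ¬ ∀ c ∈ cs, c.IsConcrete) :
    BaseValRefine E Γ memInjId Δ Δ (baseValUnflatten E Γ (.int τi) cs) vb (.int τi) := by
  rw [baseValUnflatten, if_neg hc]
  split_ifs with h1
  · obtain ⟨rfl, h1⟩ := h1
    have hl : cs.length = E.charBits := by
      rw [hcs.length_eq, h.length_flatten]
      exact bitSize_uchar E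
    exact .byte cs vb (.byte cs (Bit.Le.forall_valid hcs h.flatten_valid) hl hc h1) h
      (Bit.Le.forall₂_refine hcs h.flatten_valid)
  · exact .indet vb _ nofun h

/-- Reading back the representation of a base value, possibly with some bits made indeterminate,
gives a base value that refines to the original one. -/
theorem BaseValTyped.baseValUnflatten_refine {vb : BaseVal K} {τb : BaseType K}
    (h : BaseValTyped E Γ Δ vb τb) {cs : List (Bit K)}
    (hcs : List.Forall₂ Bit.Le cs (vb.flatten E Γ)) :
    BaseValRefine E Γ memInjId Δ Δ (baseValUnflatten E Γ τb cs) vb τb := by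
  cases τb with
  | void =>
    cases h with
    | void => exact .void
    | indet _ _ h => exact absurd rfl h
  | int τi =>
    by_cases hc : ∀ c ∈ cs, c.IsConcrete
    · obtain rfl := Bit.Le.eq_of_ne_indet hcs fun c h => (hc c h).ne_indet
      cases h with
      | indet _ h1 h2 =>
        obtain ⟨b, hb⟩ := List.exists_mem_of_length_pos
          (l := (BaseVal.indet (.int τi)).flatten E Γ)
          (by simpa [BaseVal.flatten] using bitSize_base_pos E _)
        exact absurd (List.eq_of_mem_replicate hb) (hc b hb).ne_indet
      | int x _ hx =>
        rw [baseValUnflatten, if_pos hc, BaseVal.flatten, List.map_map]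
        have h1 : Bit.toBool ∘ Bit.bit (K := K) = id := rfl
        rw [h1, List.map_id, intOfBits_intToBits _ hx]
        exact .int x τi hx
      | byte bs _ _ hn => exact absurd hc hn
    · exact h.refine_of_not_concrete hcs hc
  | ptr σp =>
    rw [baseValUnflatten]
    split_ifs with hp
    · generalize hp.choose = p, hp.choose_spec = hp
      obtain ⟨rfl, hp⟩ := hp
      have h1 := Bit.Le.eq_of_ne_indet hcs ptrBits_ne_indet
      cases h with
      | indet _ _ _ =>
        refine absurd ?_ (ptrBits_ne_indet _ (first_mem_ptrBits E Γ σp p))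
        have h2 := first_mem_ptrBits E Γ σp p
        rw [h1] at h2
        exact List.eq_of_mem_replicate h2
      | ptr q _ hq =>
        rw [BaseVal.flatten, hq.typeOf_eq] at h1
        rw [ptrBits_injective h1]
        exact .ptr _ _ _ hq.freeze_refine
    · exact .indet vb _ nofun h

/-- Less determined bits denote a base value that refines to the one of the given bits. -/
theorem baseValUnflatten_mono {τb : BaseType K} (hτb : BaseTypeValid Γ τb)
    {bs cs : List (Bit K)} (hbs : ∀ b ∈ bs, BitValid E Γ Δ b)
    (hl : bs.length = bitSize E Γ (.base τb)) (hcs : List.Forall₂ Bit.Le cs bs) :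
    BaseValRefine E Γ memInjId Δ Δ (baseValUnflatten E Γ τb cs) (baseValUnflatten E Γ τb bs)
      τb := by
  have ht := baseValTyped_baseValUnflatten hτb hbs hl
  rcases flatten_baseValUnflatten hbs hl with h | rfl | ⟨hv, h⟩
  · exact ht.baseValUnflatten_refine (h.symm ▸ hcs)
  · exact .void
  · rw [h cs hcs]
    exact .indet _ _ hv ht

end BaseValues

/-! ### Values denoted by sequences of bits -/

theorem forall₂_splitLengths {α β : Type*} {R : α → β → Prop} (zs : List ℕ) {l₁ : List α}
    {l₂ : List β} (h : List.Forall₂ R l₁ l₂) :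
    List.Forall₂ (List.Forall₂ R) (zs.splitLengths l₁) (zs.splitLengths l₂) := by
  induction zs generalizing l₁ l₂ with
  | nil => exact .nil
  | cons z zs ih =>
    rw [List.splitLengths_cons, List.splitLengths_cons]
    exact .cons (List.forall₂_take z h) (ih (List.forall₂_drop z h))

theorem forall₂_getElem? {α β : Type*} {R : α → β → Prop} {l₁ : List α} {l₂ : List β}
    (h : List.Forall₂ R l₁ l₂) {i : ℕ} {a : α} {b : β} (ha : l₁[i]? = some a)
    (hb : l₂[i]? = some b) : R a b := by
  obtain ⟨h1, rfl⟩ := List.getElem?_eq_some_iff.1 ha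
  obtain ⟨h2, rfl⟩ := List.getElem?_eq_some_iff.1 hb
  exact (List.forall₂_iff_get.1 h).2 i h1 h2

section Values

variable {K : Type*} [LinearOrder K] (E : ImplEnv K) (Γ : Env K)

theorem valUnflatten_base (τb : BaseType K) (bs : List (Bit K)) :
    valUnflatten E Γ (.base τb) bs = .base (baseValUnflatten E Γ τb bs) := by
  simp [valUnflatten, typeRec, typeRecAux]

theorem valUnflatten_array (τ : CType K) (n : ℕ) (bs : List (Bit K)) :
    valUnflatten E Γ (.array τ n) bs =
      .array τ (((List.replicate n (bitSize E Γ τ)).splitLengths bs).map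
        (valUnflatten E Γ τ)) := by
  rw [valUnflatten, typeRec_array]

variable {Γ}

theorem valUnflatten_struct (hΓ : EnvValid Γ) {t : String} {τs : List (CType K)}
    (ht : Γ.fields t = some τs) (bs : List (Bit K)) :
    valUnflatten E Γ (.struct t) bs = .struct t (List.zipWith
      (fun τ p => valUnflatten E Γ τ (p.take (bitSize E Γ τ)))
      τs ((fieldBitSizes E Γ τs).splitLengths bs)) := by
  rw [valUnflatten, typeRec_struct _ _ _ _ hΓ t τs ht]
  simp [List.zipWith_map_left, Function.comp_def]

theorem valUnflatten_union (hΓ : EnvValid Γ) {t : String} {τs : List (CType K)}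
    (ht : Γ.fields t = some τs) (bs : List (Bit K)) :
    valUnflatten E Γ (.union t) bs =
      .unionAll t (τs.map fun τ => valUnflatten E Γ τ (bs.take (bitSize E Γ τ))) := by
  rw [valUnflatten, typeRec_union _ _ _ _ hΓ t τs ht]
  simp [Function.comp_def]

/-- The variant of `forall₂_flatten_zipWith_splitLengths` in which each result is padded to the
length of its chunk. -/
theorem forall₂_flatten_takeD_splitLengths {α β γ δ : Type*} {R : β → γ → Prop}
    {P : α → ℕ → Prop} {g : α → List γ → δ} {f : δ → List β} {d : β} {as : List α}
    {zs : List ℕ} (h : List.Forall₂ P as zs)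
    (hg : ∀ a z, a ∈ as → P a z → ∀ p : List γ, p.length = z →
      List.Forall₂ R (List.takeD z (f (g a p)) d) p)
    {l : List γ} (hl : l.length = zs.sum) :
    List.Forall₂ R (List.zipWith (fun z bs => List.takeD z bs d) zs
      ((List.zipWith g as (zs.splitLengths l)).map f)).flatten l := by
  induction h generalizing l with
  | nil => simpa using hl
  | @cons a z as zs h1 _ ih =>
    rw [List.sum_cons] at hl
    rw [List.splitLengths_cons, List.zipWith_cons_cons, List.map_cons, List.zipWith_cons_cons,
      List.flatten_cons]
    conv_rhs => rw [← List.take_append_drop z l]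
    exact List.rel_append
      (hg a z List.mem_cons_self h1 _ (by rw [List.length_take]; omega))
      (ih (fun a z ha => hg a z (List.mem_cons_of_mem _ ha)) (by rw [List.length_drop]; omega))

variable {E} {Δ : MemEnv K}

/-- The value denoted by a sequence of bits carries no more information than these bits. -/
theorem flatten_valUnflatten_le (hΓ : EnvValid Γ) {τ : CType K} (hτ : TypeValid Γ τ)
    {bs : List (Bit K)} (hbs : ∀ b ∈ bs, BitValid E Γ Δ b) (hl : bs.length = bitSize E Γ τ) :
    List.Forall₂ Bit.Le ((valUnflatten E Γ τ bs).flatten E Γ) bs := by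
  -- The lemmas on splitting lists say nothing on which elements occur in a chunk, so validity is
  -- made part of the type of the elements.
  suffices h : ∀ bs : List {b : Bit K // BitValid E Γ Δ b}, bs.length = bitSize E Γ τ →
      List.Forall₂ (fun (c : Bit K) (b : {b : Bit K // BitValid E Γ Δ b}) => Bit.Le c b.1)
        ((valUnflatten E Γ τ (bs.map Subtype.val)).flatten E Γ) bs by
    lift bs to List {b : Bit K // BitValid E Γ Δ b} using hbs
    rw [List.forall₂_map_right_iff]
    exact h bs (by simpa using hl)
  clear hbs hl bs
  intro bs hl
  have hv : ∀ bs : List {b : Bit K // BitValid E Γ Δ b},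
      ∀ b ∈ bs.map Subtype.val, BitValid E Γ Δ b := by
    intro bs b hb
    obtain ⟨c, _, rfl⟩ := List.mem_map.1 hb
    exact c.2
  induction hτ using TypeValid.ind hΓ generalizing bs with
  | base τb =>
    rw [valUnflatten_base, Val.flatten, ← List.forall₂_map_right_iff]
    exact flatten_baseValUnflatten_le (hv bs) (by simpa using hl)
  | array τ n hτ hn ih =>
    rw [valUnflatten_array, Val.flatten, map_splitLengths, List.map_map, List.map_map]
    exact forall₂_map_flatten_splitLengths_replicate (fun p hp => ih p hp)
      (hl.trans (bitSize_array E τ n))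
  | struct t τs ht hτs ih =>
    rw [valUnflatten_struct E hΓ ht, Val.flatten, ht, Option.getD_some, map_splitLengths,
      List.zipWith_map_right (l₁ := τs)]
    refine forall₂_flatten_takeD_splitLengths (fieldBitSizes_ge E hΓ τs) ?_
      (hl.trans (sum_fieldBitSizes E hΓ ht).symm)
    rintro τ _ hτ hz p rfl
    rw [← List.forall₂_map_right_iff, ← List.length_map (f := Subtype.val)]
    refine Bit.Le.takeD (k := bitSize E Γ τ) ?_
    rw [← List.map_take, List.forall₂_map_right_iff]
    exact ih τ hτ _ (by rw [List.length_take]; omega)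
  | union t τs ht hτs ih =>
    rw [valUnflatten_union E hΓ ht, Val.flatten, List.map_map, ← List.forall₂_map_right_iff]
    refine Bit.Le.foldr_join (by simpa using hl) fun cs hcs => ?_
    obtain ⟨τ, hτ, rfl⟩ := List.mem_map.1 hcs
    rw [← hl, ← List.length_map (f := Subtype.val)]
    refine Bit.Le.takeD (k := bitSize E Γ τ) ?_
    have hle := bitSize_le_union E hΓ ht hτ
    rw [Function.comp_apply, ← List.map_take, List.forall₂_map_right_iff]
    exact ih τ hτ _ (by rw [List.length_take]; omega)

/-- Less determined bits denote a value that refines to the one of the given bits. -/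
theorem valUnflatten_mono (hΓ : EnvValid Γ) {τ : CType K} (hτ : TypeValid Γ τ)
    {bs cs : List (Bit K)} (hbs : ∀ b ∈ bs, BitValid E Γ Δ b)
    (hl : bs.length = bitSize E Γ τ) (hcs : List.Forall₂ Bit.Le cs bs) :
    ValRefine E Γ memInjId Δ Δ (valUnflatten E Γ τ cs) (valUnflatten E Γ τ bs) τ := by
  induction hτ using TypeValid.ind hΓ generalizing bs cs with
  | base τb hτb =>
    rw [valUnflatten_base, valUnflatten_base]
    exact .base _ _ _ (baseValUnflatten_mono hτb hbs hl hcs)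
  | array τ n hτ hn ih =>
    rw [valUnflatten_array, valUnflatten_array]
    have h := ValRefine.array (E := E) (Γ := Γ) (f := memInjId) (Δ₁ := Δ) (Δ₂ := Δ) τ
      (((List.replicate n (bitSize E Γ τ)).splitLengths cs).map (valUnflatten E Γ τ))
      (((List.replicate n (bitSize E Γ τ)).splitLengths bs).map (valUnflatten E Γ τ))
    simp only [List.length_map, List.length_splitLengths, List.length_replicate] at h
    refine h hn trivial fun i v₁ v₂ h1 h2 => ?_
    rw [List.getElem?_map, Option.map_eq_some_iff] at h1 h2
    obtain ⟨p, hp, rfl⟩ := h1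
    obtain ⟨q, hq, rfl⟩ := h2
    obtain ⟨h3, h4⟩ := getElem?_splitLengths
      (by rw [List.sum_replicate, smul_eq_mul, hl, bitSize_array]) hq
    refine ih (fun b hb => hbs b (h4 b hb)) ?_
      (forall₂_getElem? (forall₂_splitLengths _ hcs) hp hq)
    rw [List.getElem?_replicate] at h3
    split at h3 <;> simp_all
  | struct t τs ht hτs ih =>
    have hz := fieldBitSizes_ge E hΓ τs
    have hlen : ∀ bs : List (Bit K), (List.zipWith
        (fun τ p => valUnflatten E Γ τ (p.take (bitSize E Γ τ)))
        τs ((fieldBitSizes E Γ τs).splitLengths bs)).length = τs.length := by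
      simp [hz.length_eq]
    rw [valUnflatten_struct E hΓ ht, valUnflatten_struct E hΓ ht]
    refine .struct t τs _ _ ht (hlen cs) (hlen bs) fun i v₁ v₂ τ h1 h2 hi => ?_
    obtain ⟨_, p, hi1, hp, rfl⟩ := List.getElem?_zipWith_eq_some.1 h1
    obtain ⟨_, q, hi2, hq, rfl⟩ := List.getElem?_zipWith_eq_some.1 h2
    obtain rfl := Option.some_inj.1 (hi.symm.trans hi1)
    obtain rfl := Option.some_inj.1 (hi.symm.trans hi2)
    obtain ⟨h3, h4⟩ := getElem?_splitLengths (by rw [hl, sum_fieldBitSizes E hΓ ht]) hq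
    have h5 := forall₂_getElem? hz hi h3
    exact ih τ (List.mem_of_getElem? hi) (fun b hb => hbs b (h4 b (List.mem_of_mem_take hb)))
      (by rw [List.length_take]; omega)
      (List.forall₂_take _ (forall₂_getElem? (forall₂_splitLengths _ hcs) hp hq))
  | union t τs ht hτs ih =>
    rw [valUnflatten_union E hΓ ht, valUnflatten_union E hΓ ht]
    refine .unionAll t τs _ _ ht (List.length_map _) (List.length_map _)
      (fun i v₁ v₂ τ h1 h2 hi => ?_)
      ⟨cs, Bit.Le.forall_valid hcs hbs, hcs.length_eq.trans hl, rfl⟩ ⟨bs, hbs, hl, rfl⟩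
    rw [List.getElem?_map, hi, Option.map_some, Option.some_inj] at h1 h2
    subst h1 h2
    have hτ := List.mem_of_getElem? hi
    have hle := bitSize_le_union E hΓ ht hτ
    exact ih τ hτ (fun b hb => hbs b (List.mem_of_mem_take hb))
      (by rw [List.length_take]; omega) (List.forall₂_take _ hcs)

end Values

/-! ### Values stored in memory trees -/

section Storing

variable {K : Type*} [LinearOrder K] {E : ImplEnv K} {Γ : Env K} {Δ : MemEnv K}

theorem ValTyped.typeOf_eq {v : Val K} {τ : CType K} (h : ValTyped E Γ Δ v τ) :
    v.typeOf E = τ := by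
  cases h with
  | base vb τb h => rw [Val.typeOf, h.typeOf_eq]
  | _ => rfl

theorem zip_map_fst {α β : Type*} {l₁ : List α} {l₂ : List β} (h : l₁.length = l₂.length) :
    (l₁.zip l₂).map Prod.fst = l₁ :=
  List.map_fst_zip h.le

theorem zip_map_snd {α β : Type*} {l₁ : List α} {l₂ : List β} (h : l₁.length = l₂.length) :
    (l₁.zip l₂).map Prod.snd = l₂ :=
  List.map_snd_zip h.ge

variable (E Γ) in
theorem ofVal_struct {t : String} {τs : List (CType K)} (ht : Γ.fields t = some τs)
    (vs : List (Val K)) (γs : List Perm) :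
    ofVal E Γ (.struct t vs) γs = .struct t (List.zipWith
      (fun v (q : CType K × List Perm) => (ofVal E Γ v (q.2.take (bitSize E Γ q.1)),
        (q.2.drop (bitSize E Γ q.1)).map fun γ => (γ, Bit.indet)))
      vs (τs.zip ((fieldBitSizes E Γ τs).splitLengths γs))) := by
  rw [ofVal, ht, Option.getD_some, List.zipWith_map_left]

/-- Each field of a stored struct is made from a chunk `p` of the permissions. -/
theorem getElem?_ofVal_struct (hΓ : EnvValid Γ) {t : String} {τs : List (CType K)}
    (ht : Γ.fields t = some τs) {vs : List (Val K)} {γs : List Perm}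
    (hl : γs.length = bitSize E Γ (.struct t)) {i : ℕ} {f : MTree K × List (PBit K)}
    (h : (List.zipWith
      (fun v (q : CType K × List Perm) => (ofVal E Γ v (q.2.take (bitSize E Γ q.1)),
        (q.2.drop (bitSize E Γ q.1)).map fun γ => (γ, Bit.indet)))
      vs (τs.zip ((fieldBitSizes E Γ τs).splitLengths γs)))[i]? = some f) :
    ∃ v τ, ∃ p : List Perm, vs[i]? = some v ∧ τs[i]? = some τ ∧ bitSize E Γ τ ≤ p.length ∧
      (∀ γ ∈ p, γ ∈ γs) ∧ f = (ofVal E Γ v (p.take (bitSize E Γ τ)),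
        (p.drop (bitSize E Γ τ)).map fun γ => (γ, Bit.indet)) := by
  obtain ⟨v, ⟨τ, p⟩, hv, hq, rfl⟩ := List.getElem?_zipWith_eq_some.1 h
  obtain ⟨hτ, hp⟩ := List.getElem?_zip_eq_some.1 hq
  obtain ⟨h1, h2⟩ := getElem?_splitLengths (by rw [hl, sum_fieldBitSizes E hΓ ht]) hp
  exact ⟨v, τ, p, hv, hτ, forall₂_getElem? (fieldBitSizes_ge E hΓ τs) hτ h1, h2, rfl⟩

theorem ofVal_array (τ : CType K) (vs : List (Val K)) (γs : List Perm) :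
    ofVal E Γ (.array τ vs) γs = .array τ (List.zipWith (ofVal E Γ) vs
      ((List.replicate vs.length (bitSize E Γ τ)).splitLengths γs)) := by
  rw [ofVal, List.zipWith_map_left]

theorem getElem?_ofVal_array {τ : CType K} {vs : List (Val K)} {γs : List Perm}
    (hl : γs.length = bitSize E Γ (.array τ vs.length)) {i : ℕ} {w : MTree K}
    (h : (List.zipWith (ofVal E Γ) vs
      ((List.replicate vs.length (bitSize E Γ τ)).splitLengths γs))[i]? = some w) :
    ∃ v p, vs[i]? = some v ∧ p.length = bitSize E Γ τ ∧ (∀ γ ∈ p, γ ∈ γs) ∧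
      w = ofVal E Γ v p := by
  obtain ⟨v, p, hv, hp, rfl⟩ := List.getElem?_zipWith_eq_some.1 h
  obtain ⟨h1, h2⟩ := getElem?_splitLengths
    (by rw [List.sum_replicate, smul_eq_mul, hl, bitSize_array]) hp
  refine ⟨v, p, hv, ?_, h2, rfl⟩
  rw [List.getElem?_replicate] at h1
  split at h1 <;> simp_all

theorem ValTyped.perm_mem_ofVal (hΓ : EnvValid Γ) {v : Val K} {τ : CType K}
    (h : ValTyped E Γ Δ v τ) {γs : List Perm} (hl : γs.length = bitSize E Γ τ) :
    ∀ b ∈ (ofVal E Γ v γs).flatten, b.1 ∈ γs := by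
  induction h generalizing γs with
  | base vb τb h =>
    rw [ofVal, MTree.flatten]
    exact fun b hb => (List.of_mem_zip hb).1
  | array τ vs _ _ ih =>
    rw [ofVal_array, MTree.flatten]
    intro b hb
    obtain ⟨w, hw, hb⟩ := List.mem_flatMap.1 hb
    obtain ⟨i, hi⟩ := List.mem_iff_getElem?.1 hw
    obtain ⟨v, p, hv, hp, hm, rfl⟩ := getElem?_ofVal_array hl hi
    exact hm _ (ih v (List.mem_of_getElem? hv) hp b hb)
  | struct t vs τs ht hlen _ ih =>
    rw [ofVal_struct E Γ ht, MTree.flatten]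
    intro b hb
    obtain ⟨f, hf, hb⟩ := List.mem_flatMap.1 hb
    obtain ⟨i, hi⟩ := List.mem_iff_getElem?.1 hf
    obtain ⟨v, τ, p, hv, hτ, hp, hm, rfl⟩ := getElem?_ofVal_struct hΓ ht hl hi
    rcases List.mem_append.1 hb with hb | hb
    · exact hm _ (List.mem_of_mem_take
        (ih i v τ hv hτ (by rw [List.length_take]; omega) b hb))
    · obtain ⟨γ, hγ, rfl⟩ := List.mem_map.1 hb
      exact hm γ (List.mem_of_mem_drop hγ)
  | union t i v τ hi hv ih =>
    obtain ⟨τs, ht, hi⟩ := Env.field_eq_some.1 hi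
    have hle := bitSize_le_union E hΓ ht (List.mem_of_getElem? hi)
    rw [ofVal, MTree.flatten, hv.typeOf_eq]
    intro b hb
    rcases List.mem_append.1 hb with hb | hb
    · exact List.mem_of_mem_take (ih (by rw [List.length_take]; omega) b hb)
    · obtain ⟨γ, hγ, rfl⟩ := List.mem_map.1 hb
      exact List.mem_of_mem_take (List.mem_of_mem_drop hγ)
  | unionAll t vs τs _ _ _ _ _ =>
    rw [ofVal, MTree.flatten]
    exact fun b hb => (List.of_mem_zip hb).1

/-- The join of the representations of all variants of a union carries no more information than
their common representation. -/
theorem flatten_unionAll_le (hΓ : EnvValid Γ) {t : String} {τs : List (CType K)}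
    (ht : Γ.fields t = some τs) {bs : List (Bit K)} (hbs : ∀ b ∈ bs, BitValid E Γ Δ b)
    (hl : bs.length = bitSize E Γ (.union t)) :
    List.Forall₂ Bit.Le ((Val.unionAll t (τs.map fun τ =>
      valUnflatten E Γ τ (bs.take (bitSize E Γ τ)))).flatten E Γ) bs := by
  rw [← valUnflatten_union E hΓ ht]
  exact flatten_valUnflatten_le hΓ (.union t (Finmap.mem_of_lookup_eq_some ht)) hbs hl

/-- Reading back the memory tree of a stored value gives a value that refines to it. -/
theorem ValTyped.toVal_ofVal_refine (hΓ : EnvValid Γ) {v : Val K} {τ : CType K}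
    (h : ValTyped E Γ Δ v τ) {γs : List Perm} (hl : γs.length = bitSize E Γ τ) :
    ValRefine E Γ memInjId Δ Δ (toVal E Γ (ofVal E Γ v γs)) v τ := by
  induction h generalizing γs with
  | base vb τb h =>
    rw [ofVal, toVal, zip_map_snd (hl.trans h.length_flatten.symm), h.typeOf_eq]
    exact .base _ _ _ (h.baseValUnflatten_refine (Bit.Le.forall₂_refl _))
  | array τ vs _ hn ih =>
    rw [ofVal_array, toVal]
    have h := ValRefine.array (E := E) (Γ := Γ) (f := memInjId) (Δ₁ := Δ) (Δ₂ := Δ) τ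
      ((List.zipWith (ofVal E Γ) vs
        ((List.replicate vs.length (bitSize E Γ τ)).splitLengths γs)).map (toVal E Γ)) vs
    simp only [List.length_map, List.length_zipWith, List.length_splitLengths,
      List.length_replicate, min_self] at h
    refine h hn trivial fun i v₁ v₂ h1 h2 => ?_
    rw [List.getElem?_map, Option.map_eq_some_iff] at h1
    obtain ⟨w, hw, rfl⟩ := h1
    obtain ⟨v, p, hv, hp, _, rfl⟩ := getElem?_ofVal_array hl hw
    obtain rfl := Option.some_inj.1 (h2.symm.trans hv)
    exact ih v₂ (List.mem_of_getElem? hv) hp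
  | struct t vs τs ht hlen _ ih =>
    rw [ofVal_struct E Γ ht, toVal]
    refine .struct t τs _ _ ht ?_ hlen fun i v₁ v₂ τ h1 h2 hi => ?_
    · simp [hlen, ← (fieldBitSizes_ge E hΓ τs).length_eq]
    · rw [List.getElem?_map, Option.map_eq_some_iff] at h1
      obtain ⟨f, hf, rfl⟩ := h1
      obtain ⟨v, τ', p, hv, hτ, hp, _, rfl⟩ := getElem?_ofVal_struct hΓ ht hl hf
      obtain rfl := Option.some_inj.1 (h2.symm.trans hv)
      obtain rfl := Option.some_inj.1 (hi.symm.trans hτ)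
      exact ih i v₂ τ hv hτ (by rw [List.length_take]; omega)
  | union t i v τ hi hv ih =>
    obtain ⟨τs, ht, hi'⟩ := Env.field_eq_some.1 hi
    have hle := bitSize_le_union E hΓ ht (List.mem_of_getElem? hi')
    rw [ofVal, toVal, hv.typeOf_eq]
    exact .union t i τ _ _ hi (ih (by rw [List.length_take]; omega))
  | unionAll t vs τs ht hlen _ hrep _ =>
    obtain ⟨bs, hbs, hbl, rfl⟩ := hrep
    have hle := flatten_unionAll_le hΓ ht hbs hbl
    rw [ofVal, toVal, zip_map_snd (by rw [hl, hle.length_eq, hbl]),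
      ← valUnflatten_union E hΓ ht bs]
    exact valUnflatten_mono hΓ (.union t (Finmap.mem_of_lookup_eq_some ht)) hbs hbl
      (valUnflatten_union E hΓ ht bs ▸ hle)

theorem KindLE.readable_of_writable {k : Option PermKind} (h : KindLE (some .writable) k) :
    KindLE (some .readable) k := by
  cases h
  exact .readable_writable

/-! ### Lookup after a store -/

theorem cmapLookup_eq_some {a : Addr K} {m : Mem K} {w : MTree K}
    (h : cmapLookup E Γ a m = some w) :
    ∃ w₀ μ w₁, m.lookup a.idx = some (.obj w₀ μ) ∧ a.Strict E Γ ∧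
      mtreeLookup E Γ (a.normRef E Γ) w₀ = some w₁ ∧
      (¬ a.IsByte → w = w₁) ∧
      (a.IsByte → w = .base (.int (ucharInt E)) (byteSlice E (a.byteOff E Γ) w₁.flatten)) := by
  unfold cmapLookup at h
  split at h
  · rename_i w₀ μ hm
    split at h
    · rename_i hs
      obtain ⟨w₁, hw₁, rfl⟩ := Option.map_eq_some_iff.1 h
      refine ⟨w₀, μ, w₁, hm, hs, hw₁, fun hb => if_neg hb, fun hb => ?_⟩
      rw [if_pos hb, uchar, mtreeUnflatten_base]
    · simp at h
  · simp at h

theorem cmapLookup_cmapAlter {f : MTree K → MTree K} {a : Addr K} {m : Mem K}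
    {w₀ w₁ : MTree K} {μ : Bool} (hm : m.lookup a.idx = some (.obj w₀ μ)) (hs : a.Strict E Γ)
    (hw : mtreeLookup E Γ (a.normRef E Γ) w₀ = some w₁) :
    (¬ a.IsByte → cmapLookup E Γ a (cmapAlter E Γ f a m) = some (f w₁)) ∧
    (a.IsByte → cmapLookup E Γ a (cmapAlter E Γ f a m) = some (.base (.int (ucharInt E))
      (byteSlice E (a.byteOff E Γ) (alterByte E Γ f (a.byteOff E Γ) w₁).flatten))) := by
  constructor <;> intro hb
  · simp [cmapAlter, hm, cmapLookup, hs, hb, mtreeLookup_mtreeAlter f hw]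
  · simp [cmapAlter, hm, cmapLookup, hs, hb,
      mtreeLookup_mtreeAlter (alterByte E Γ f (a.byteOff E Γ)) hw, uchar, mtreeUnflatten_base]

theorem MemValid.typed_of_lookup {m : Mem K} (hm : MemValid E Γ Δ m) {o : Index} {τ : CType K}
    {w : MTree K} {μ : Bool} (ho : IndexTyped Δ o τ) (h : m.lookup o = some (.obj w μ)) :
    MTreeTyped E Γ Δ w τ := by
  obtain ⟨τ', ⟨β', h'⟩, _, hw, _⟩ := hm.2 o w μ h
  obtain ⟨β, ho⟩ := ho
  rw [ho] at h'
  cases h'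
  exact hw

theorem AddrTyped.normRef_typed {a : Addr K} {σp : PtrType K} (h : AddrTyped E Γ Δ a σp)
    (hs : a.Strict E Γ) : RefTyped Γ (a.normRef E Γ) a.objType a.subType := by
  cases h with
  | mk o τ r i σ σp h1 h2 h3 => exact h3.setOffset (Nat.div_lt_of_lt_mul hs)

theorem byteSlice_splice {α : Type*} {i : ℕ} {l p : List α} (hp : p.length = E.charBits)
    (hi : i * E.charBits ≤ l.length) :
    byteSlice E i (l.take (i * E.charBits) ++ p ++ l.drop ((i + 1) * E.charBits)) = p := by
  have h : (l.take (i * E.charBits)).length = i * E.charBits := by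
    rw [List.length_take]; omega
  rw [byteSlice, List.append_assoc, List.drop_left' h, List.take_left' hp]

theorem length_byteSlice {α : Type*} {i : ℕ} {l : List α}
    (hi : (i + 1) * E.charBits ≤ l.length) : (byteSlice E i l).length = E.charBits := by
  rw [Nat.succ_mul] at hi
  rw [byteSlice, List.length_take, List.length_drop]
  omega

/-- After a store of a byte, the bits of that byte are those that were stored, except that the
bits which belong to padding are indeterminate. -/
theorem byteSlice_alterByte_le (hΓ : EnvValid Γ) {σ : CType K} (hσ : TypeValid Γ σ) {w : MTree K}
    (hw : MTreeTyped E Γ Δ w σ) {f : MTree K → MTree K} {i : ℕ}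
    (hi : (i + 1) * E.charBits ≤ bitSize E Γ σ)
    (hf : (f (.base (.int (ucharInt E)) (byteSlice E i w.flatten))).flatten.length =
      E.charBits) :
    List.Forall₂ PBit.Le (byteSlice E i (alterByte E Γ f i w).flatten)
      (f (.base (.int (ucharInt E)) (byteSlice E i w.flatten))).flatten := by
  have hl := hw.length_flatten hΓ
  rw [← hl] at hi
  have hi' := hi
  rw [Nat.succ_mul] at hi'
  rw [alterByte, hw.typeOf_eq, uchar, mtreeUnflatten_base]
  generalize (f (.base (.int (ucharInt E)) (byteSlice E i w.flatten))).flatten = p at hf ⊢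
  conv_rhs => rw [← byteSlice_splice (E := E) (i := i) (l := w.flatten) hf (by omega)]
  refine List.forall₂_take _ (List.forall₂_drop _ (flatten_mtreeUnflatten_le E hΓ hσ ?_))
  simp only [List.length_append, List.length_take, List.length_drop, Nat.succ_mul]
  omega

theorem AddrTyped.type_of_isByte {a : Addr K} {τ : CType K} (h : AddrTyped E Γ Δ a (.type τ))
    (hb : a.IsByte) : τ = uchar E := by
  cases h with
  | mk o τ' r i σ _ h1 h2 h3 h4 h5 h6 h7 =>
    cases h7 with
    | self => exact absurd rfl hb
    | uchar => rfl

theorem AddrTyped.type_of_not_isByte {a : Addr K} {τ : CType K}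
    (h : AddrTyped E Γ Δ a (.type τ)) (hb : ¬ a.IsByte) : a.subType = τ := by
  cases h with
  | mk o τ' r i σ _ h1 h2 h3 h4 h5 h6 h7 =>
    simpa [Addr.IsByte] using hb

theorem AddrTyped.objType_valid {a : Addr K} {σp : PtrType K} (h : AddrTyped E Γ Δ a σp) :
    IndexTyped Δ a.idx a.objType ∧ TypeValid Γ a.objType := by
  cases h with
  | mk o τ' r i σ _ h1 h2 => exact ⟨h1, h2⟩

end Storing
end CH2O

open CH2O in
theorem theorem2 {K : Type*} [LinearOrder K] (E : CH2O.ImplEnv K) (Γ : CH2O.Env K)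
    (hΓ : CH2O.EnvValid Γ) (Δ : CH2O.MemEnv K) (m : CH2O.Mem K) (a : CH2O.Addr K)
    (v : CH2O.Val K) (τ : CH2O.CType K)
    (hm : CH2O.MemValid E Γ Δ m) (ha : CH2O.AddrTyped E Γ Δ a (.type τ))
    (hv : CH2O.ValTyped E Γ Δ v τ) (hw : CH2O.MemWritable E Γ a m) :
    ∃ v' : CH2O.Val K,
      CH2O.memLookup E Γ a (CH2O.memInsert E Γ a v m) = some v' ∧
      CH2O.ValRefine E Γ CH2O.memInjId Δ Δ v' v τ := by
  obtain ⟨w, hw, hwr⟩ := hw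
  obtain ⟨w₀, μ, w₁, hm₀, hs, hw₁, hnb, hb⟩ := cmapLookup_eq_some hw
  obtain ⟨hidx, hval⟩ := ha.objType_valid
  have hr := ha.normRef_typed hs
  have ht₁ := (hm.typed_of_lookup hidx hm₀).mtreeLookup hΓ hr hw₁
  have hσ := hr.typeValid hΓ hval
  have hread : ∀ γ ∈ w.flatten.map Prod.fst, KindLE (some .readable) γ.kind := by
    intro γ hγ
    obtain ⟨b, hb, rfl⟩ := List.mem_map.1 hγ
    exact (hwr b hb).readable_of_writable
  obtain ⟨hnb', hb'⟩ := cmapLookup_cmapAlter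
    (f := fun w => ofVal E Γ v (w.flatten.map Prod.fst)) hm₀ hs hw₁
  by_cases hbyte : a.IsByte
  · obtain rfl := ha.type_of_isByte hbyte
    obtain rfl := hb hbyte
    rw [MTree.flatten] at hread
    have hoff : a.byteOff E Γ < E.sizeOf Γ a.subType :=
      Nat.mod_lt _ (Nat.pos_of_ne_zero fun h0 => by simp [Addr.Strict, h0] at hs)
    have hi : (a.byteOff E Γ + 1) * E.charBits ≤ bitSize E Γ a.subType :=
      Nat.mul_le_mul_right _ hoff
    have hls : (byteSlice E (a.byteOff E Γ) w₁.flatten).length = E.charBits :=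
      length_byteSlice (hi.trans (ht₁.length_flatten hΓ).ge)
    cases hv with
    | base vb _ hvb =>
      have hlz : ((byteSlice E (a.byteOff E Γ) w₁.flatten).map Prod.fst).length =
          (vb.flatten E Γ).length := by
        rw [List.length_map, hls, hvb.length_flatten]
        exact (bitSize_uchar E).symm
      have hle := byteSlice_alterByte_le hΓ hσ ht₁
        (f := fun w => ofVal E Γ (.base vb) (w.flatten.map Prod.fst)) hi (by
          simp only [MTree.flatten, ofVal]
          rw [List.length_zip, ← hlz, min_self, List.length_map, hls])
      simp only [MTree.flatten, ofVal] at hle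
      refine ⟨_, ?_, .base _ vb _ (hvb.baseValUnflatten_refine
        (zip_map_snd hlz ▸ PBit.Le.map_snd hle))⟩
      rw [memLookup, memInsert, hb' hbyte, Option.bind_some, if_pos, toVal]
      · simp only [ofVal]
      intro b hb
      simp only [MTree.flatten, ofVal] at hb
      refine hread _ ?_
      rw [← zip_map_fst hlz, ← PBit.Le.map_fst hle]
      exact List.mem_map_of_mem hb
  · obtain rfl := ha.type_of_not_isByte hbyte
    obtain rfl := hnb hbyte
    have hl : (w.flatten.map Prod.fst).length = bitSize E Γ a.subType := by
      rw [List.length_map, ht₁.length_flatten hΓ]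
    refine ⟨_, ?_, hv.toVal_ofVal_refine hΓ hl⟩
    rw [memLookup, memInsert, hnb' hbyte, Option.bind_some, if_pos]
    exact fun b hb => hread _ (hv.perm_mem_ofVal hΓ hl b hb)
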